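/- **The machine IMP2.** Let $\mathcal B_0,\mathcal B_1,\mathcal B_2,\dots$ be all binary strings in length-increasing lexicographic order ($\mathcal B_0=\epsilon$, $\mathcal B_1=\mathtt 0$, $\mathcal B_2=\mathtt 1$, $\mathcal B_3=\mathtt{00}$, …), let $\bar n=\mathtt 1^{|\mathcal B_n|}\cdot\mathtt 0\cdot\mathcal B_n$, and let $\langle n,y\rangle=\bar n\cdot y$ for $n\in\mathbb N$ and a binary string $y$. Sentences $P$, boolean expressions $B$ and arithmetic expressions $A$ are given by the grammar (with $N$ a natural number) $$\begin{aligned}P&\to \mathtt{skip}\mid \mathtt{x[}N\mathtt{]:=}A\mid(\mathtt{while}\ B\ \mathtt{do}\ P)\mid(P;P)\mid(\mathtt{if}\ B\ \mathtt{then}\ P\ \mathtt{else}\ P)\\ B&\to\mathtt{true}\mid\mathtt{false}\mid(A=A)\mid(A<A)\mid(B\ \mathtt{and}\ B)\mid(B\ \mathtt{or}\ B)\mid\mathtt{not}\ B\\ A&\to\mathtt{readbit}\mid N\mid\mathtt{x[}N\mathtt{]}\mid(A+A)\mid(A-A)\mid(A*A).\end{aligned}$$ A sentence is executed, with the usual meaning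 of its commands, on memory locations $\mathtt{x[0]},\mathtt{x[1]},\dots$ that hold arbitrarily large non-negative integers, initially $0$, and on an input stream of bits. Subtraction is truncated at $0$, expressions are evaluated from left to right, and the second argument of $\mathtt{and}$ / $\mathtt{or}$ is evaluated only when it is needed. The operation $\mathtt{readbit}$ returns the next unread bit of the input stream; if no bit is left, the execution never halts. Let $P_0,P_1,\dots$ be the following bijective enumeration of all sentences. In each syntactic category the finite alternatives come first, and the other production rules then alternate in the order of the grammar. The arguments of a rule are combined by Cantor's tupling functions $(x,y)\mapsto x+\binom{x+y+1}{2}$ and $(x,y,z)\mapsto x+\binom{x+y+1}{2}+\binom{x+y+z+2}{3}$. So, for $k\ge 0$, position $0$ of $A$ is $\mathtt{readbit}$ and the positions $5k+1,\dots,5k+5$ belong to the other five rules for $A$; positions $0,1$ of $B$ are $\mathtt{true},\mathtt{false}$ and the positions $5k+2,\dots,5k+6$ belong to the other five rules for $B$; position $0$ of $P$ is $\mathtt{skip}$ and the positions $4k+1,\dots,4k+4$ belong to the other four rules for $P$; here $k$ is the code of the arguments. Write $P(y)=x$ if $P$, started with all memory locations $0$ and input stream $y$, halts after reading exactly all the bits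 of $y$, and $x=\mathcal B_{\mathtt{x[0]}}\cdot\mathcal B_{\mathtt{x[1]}}\cdots$ for the final contents of the memory locations; otherwise $P(y)$ is undefined. IMP2 is the partial function on binary strings with $\mathrm{IMP2}(\langle n,y\rangle)=P_n(y)$, undefined on strings that are not of the form $\langle n,y\rangle$. **Definitions.** A *prefix machine* is a partial computable function $G$ from binary strings to binary strings whose domain is prefix-free (no element of it is a proper prefix of another one). Put $K_G(x)=\min\{|p| : G(p)=x\}$, with $K_G(x)=\infty$ if there is no such $p$. A machine $U$ is *additively optimal* for a class of machines if it belongs to the class and for every machine $G$ of the class there is a constant $c$, independent of $x$, with $K_U(x)\le K_G(x)+c$ for all $x$. **Proposition.** IMP2 is additively optimal for the class of prefix machines; in particular, it is a prefix machine. Moreover, for every prefix machine $G$ there is an $n$ with $\mathrm{IMP2}(\langle n,y\rangle)=P_n(y)=G(y)$ for every binary string $y$ (both sides may be undefined), and for every $n$ such that $P_n(y)=G(y)$ for all $y$, $$K_{\mathrm{IMP2}}(x)\le K_G(x)+2|\mathcal B_n|+1\quad\text{for all binary strings }x.$$ -/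

import Mathlib

namespace Imp2

/-! ### Binary strings and two-part codes -/

/-- The `n`-th binary string `B_n` in the length-increasing lexicographic enumeration
`ε, 0, 1, 00, 01, 10, 11, …` (`false` is the bit 0, `true` is the bit 1): the successors of a
string `B_k` by one bit are `B_(2k+1) = B_k · 0` and `B_(2k+2) = B_k · 1`. -/
def bstr : ℕ → List Bool
  | 0 => []
  | n + 1 => bstr (n / 2) ++ [decide (n % 2 = 1)]
decreasing_by omega

/-- The self-delimiting code `1^|B_n| · 0 · B_n` of `n`. -/
def selfDelim (n : ℕ) : List Bool :=
  List.replicate (bstr n).length true ++ false :: bstr n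

/-- The two-part code `⟨n, y⟩`. -/
def twoPart (n : ℕ) (y : List Bool) : List Bool :=
  selfDelim n ++ y

/-! ### Syntax -/

/-- Arithmetic expressions. -/
inductive AExp : Type
  | readbit : AExp
  | num (n : ℕ) : AExp
  | loc (n : ℕ) : AExp
  | add (a₁ a₂ : AExp) : AExp
  | sub (a₁ a₂ : AExp) : AExp
  | mul (a₁ a₂ : AExp) : AExp

/-- Boolean expressions. -/
inductive BExp : Type
  | tt : BExp
  | ff : BExp
  | eq (a₁ a₂ : AExp) : BExp
  | lt (a₁ a₂ : AExp) : BExp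
  | and (b₁ b₂ : BExp) : BExp
  | or (b₁ b₂ : BExp) : BExp
  | not (b : BExp) : BExp

/-- Sentences of the language. -/
inductive Sentence : Type
  | skip : Sentence
  | assign (n : ℕ) (a : AExp) : Sentence
  | whileDo (b : BExp) (P : Sentence) : Sentence
  | seq (P₁ P₂ : Sentence) : Sentence
  | ite (b : BExp) (P₁ P₂ : Sentence) : Sentence

/-! ### Semantics -/

/-- A state: the contents of the memory locations and the unread part of the input stream. -/
structure State : Type where
  mem : ℕ → ℕ
  input : List Bool

/-- Evaluation of arithmetic expressions, from left to right. The value is `none` if a bit is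
requested from an empty input stream (the machine then loops forever). Subtraction of
non-negative integers is truncated at `0`. -/
def AExp.eval : AExp → State → Option (ℕ × State)
  | readbit, s =>
    match s.input with
    | [] => none
    | b :: y => some (b.toNat, ⟨s.mem, y⟩)
  | num n, s => some (n, s)
  | loc n, s => some (s.mem n, s)
  | add a₁ a₂, s => do
    let (v₁, s₁) ← a₁.eval s
    let (v₂, s₂) ← a₂.eval s₁
    return (v₁ + v₂, s₂)
  | sub a₁ a₂, s => do
    let (v₁, s₁) ← a₁.eval s
    let (v₂, s₂) ← a₂.eval s₁
    return (v₁ - v₂, s₂)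
  | mul a₁ a₂, s => do
    let (v₁, s₁) ← a₁.eval s
    let (v₂, s₂) ← a₂.eval s₁
    return (v₁ * v₂, s₂)

/-- Evaluation of boolean expressions, from left to right; the second argument of a conjunction
(disjunction) is evaluated only if the first one is true (false). -/
def BExp.eval : BExp → State → Option (Bool × State)
  | tt, s => some (true, s)
  | ff, s => some (false, s)
  | eq a₁ a₂, s => do
    let (v₁, s₁) ← a₁.eval s
    let (v₂, s₂) ← a₂.eval s₁
    return (decide (v₁ = v₂), s₂)
  | lt a₁ a₂, s => do
    let (v₁, s₁) ← a₁.eval s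
    let (v₂, s₂) ← a₂.eval s₁
    return (decide (v₁ < v₂), s₂)
  | and b₁ b₂, s => do
    let (v₁, s₁) ← b₁.eval s
    if v₁ then b₂.eval s₁ else return (false, s₁)
  | or b₁ b₂, s => do
    let (v₁, s₁) ← b₁.eval s
    if v₁ then return (true, s₁) else b₂.eval s₁
  | not b, s => do
    let (v, s₁) ← b.eval s
    return (!v, s₁)

/-- `Exec P s t`: the execution of `P` from the state `s` halts in the state `t`. -/
inductive Exec : Sentence → State → State → Prop
  | skip (s : State) : Exec .skip s s
  | assign {n : ℕ} {a : AExp} {s s₁ : State} {v : ℕ} (ha : a.eval s = some (v, s₁)) :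
      Exec (.assign n a) s ⟨Function.update s₁.mem n v, s₁.input⟩
  | while_true {b : BExp} {P : Sentence} {s s₁ s₂ s₃ : State} (hb : b.eval s = some (true, s₁))
      (hP : Exec P s₁ s₂) (hw : Exec (.whileDo b P) s₂ s₃) : Exec (.whileDo b P) s s₃
  | while_false {b : BExp} {P : Sentence} {s s₁ : State} (hb : b.eval s = some (false, s₁)) :
      Exec (.whileDo b P) s s₁
  | seq {P₁ P₂ : Sentence} {s s₁ s₂ : State} (h₁ : Exec P₁ s s₁) (h₂ : Exec P₂ s₁ s₂) :
      Exec (.seq P₁ P₂) s s₂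
  | ite_true {b : BExp} {P₁ P₂ : Sentence} {s s₁ s₂ : State} (hb : b.eval s = some (true, s₁))
      (hP : Exec P₁ s₁ s₂) : Exec (.ite b P₁ P₂) s s₂
  | ite_false {b : BExp} {P₁ P₂ : Sentence} {s s₁ s₂ : State} (hb : b.eval s = some (false, s₁))
      (hP : Exec P₂ s₁ s₂) : Exec (.ite b P₁ P₂) s s₂

/-- `MemOutput σ x`: the string `x` is the concatenation `B_σ(0) · B_σ(1) · …` over all memory
locations, where all but finitely many locations contain `0` and so contribute `B_0 = ε`. -/
def MemOutput (σ : ℕ → ℕ) (x : List Bool) : Prop :=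
  ∃ m : ℕ, (∀ i, m ≤ i → σ i = 0) ∧ x = (List.range m).flatMap fun i => bstr (σ i)

/-- `P.Outputs y x`: started with all memory locations `0` and with input stream `y`, the
sentence `P` halts after reading exactly all the bits of `y`, with output `x`. -/
def Sentence.Outputs (P : Sentence) (y x : List Bool) : Prop :=
  ∃ σ : ℕ → ℕ, Exec P ⟨fun _ => 0, y⟩ ⟨σ, []⟩ ∧ MemOutput σ x

theorem Exec.det {P : Sentence} {s t t' : State} (h : Exec P s t) (h' : Exec P s t') :
    t = t' := by
  induction h generalizing t' with
  | skip s => cases h'; rfl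
  | assign ha => cases h' with | assign ha' => simp_all
  | while_true hb _ _ ih₁ ih₂ =>
    cases h' with
    | while_true hb' h₁ h₂ =>
      have := hb.symm.trans hb'
      simp only [Option.some.injEq, Prod.mk.injEq, true_and] at this
      subst this
      have := ih₁ h₁
      subst this
      exact ih₂ h₂
    | while_false hb' => simp_all
  | while_false hb =>
    cases h' with
    | while_true hb' h₁ h₂ => simp_all
    | while_false hb' => simp_all
  | seq _ _ ih₁ ih₂ =>
    cases h' with
    | seq h₁ h₂ =>
      have := ih₁ h₁
      subst this
      exact ih₂ h₂
  | ite_true hb _ ih =>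
    cases h' with
    | ite_true hb' h₁ =>
      have := hb.symm.trans hb'
      simp only [Option.some.injEq, Prod.mk.injEq, true_and] at this
      subst this
      exact ih h₁
    | ite_false hb' h₁ => simp_all
  | ite_false hb _ ih =>
    cases h' with
    | ite_true hb' h₁ => simp_all
    | ite_false hb' h₁ =>
      have := hb.symm.trans hb'
      simp only [Option.some.injEq, Prod.mk.injEq, true_and] at this
      subst this
      exact ih h₁

theorem bstr_zero : bstr 0 = [] := by simp [bstr]

theorem MemOutput.unique {σ : ℕ → ℕ} {x x' : List Bool} (h : MemOutput σ x)
    (h' : MemOutput σ x') : x = x' := by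
  have key : ∀ m k : ℕ, (∀ i, m ≤ i → σ i = 0) →
      (List.range (m + k)).flatMap (fun i => bstr (σ i)) =
        (List.range m).flatMap fun i => bstr (σ i) := by
    intro m k hm
    induction k with
    | zero => rfl
    | succ k ih =>
      rw [← Nat.add_assoc, List.range_succ, List.flatMap_append, ih]
      simp [hm (m + k) (by omega), bstr_zero]
  obtain ⟨m, hm, rfl⟩ := h
  obtain ⟨m', hm', rfl⟩ := h'
  rcases Nat.le_total m m' with hle | hle
  · obtain ⟨k, rfl⟩ := Nat.exists_eq_add_of_le hle
    exact (key m k hm).symm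
  · obtain ⟨k, rfl⟩ := Nat.exists_eq_add_of_le hle
    exact key m' k hm'

theorem Sentence.Outputs.unique {P : Sentence} {y x x' : List Bool} (h : P.Outputs y x)
    (h' : P.Outputs y x') : x = x' := by
  obtain ⟨σ, he, ho⟩ := h
  obtain ⟨σ', he', ho'⟩ := h'
  have := he.det he'
  simp only [State.mk.injEq, and_true] at this
  subst this
  exact ho.unique ho'

/-- The partial function `y ↦ P(y)` computed by a sentence `P`. -/
noncomputable def Sentence.run (P : Sentence) : List Bool →. List Bool :=
  fun y => ⟨∃ x, P.Outputs y x, fun h => h.choose⟩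

theorem Sentence.mem_run {P : Sentence} {y x : List Bool} : x ∈ P.run y ↔ P.Outputs y x :=
  ⟨fun ⟨h, e⟩ => e ▸ h.choose_spec, fun h => ⟨⟨x, h⟩, Exists.choose_spec ⟨x, h⟩ |>.unique h⟩⟩

/-! ### Enumeration of the sentences -/

/-- Cantor's pairing function. -/
def pair (x y : ℕ) : ℕ := x + (x + y + 1).choose 2

/-- Cantor's tupling function for triples. -/
def triple (x y z : ℕ) : ℕ := x + (x + y + 1).choose 2 + (x + y + z + 2).choose 3

/-- Position of an arithmetic expression: `readbit` comes first, and then the other five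
production rules alternate. -/
def AExp.rank : AExp → ℕ
  | readbit => 0
  | num n => 5 * n + 1
  | loc n => 5 * n + 2
  | add a₁ a₂ => 5 * pair a₁.rank a₂.rank + 3
  | sub a₁ a₂ => 5 * pair a₁.rank a₂.rank + 4
  | mul a₁ a₂ => 5 * pair a₁.rank a₂.rank + 5

/-- Position of a boolean expression. -/
def BExp.rank : BExp → ℕ
  | tt => 0
  | ff => 1
  | eq a₁ a₂ => 5 * pair a₁.rank a₂.rank + 2
  | lt a₁ a₂ => 5 * pair a₁.rank a₂.rank + 3
  | and b₁ b₂ => 5 * pair b₁.rank b₂.rank + 4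
  | or b₁ b₂ => 5 * pair b₁.rank b₂.rank + 5
  | not b => 5 * b.rank + 6

/-- Position of a sentence. -/
def Sentence.rank : Sentence → ℕ
  | skip => 0
  | assign n a => 4 * pair n a.rank + 1
  | .whileDo b P => 4 * pair b.rank P.rank + 2
  | seq P₁ P₂ => 4 * pair P₁.rank P₂.rank + 3
  | ite b P₁ P₂ => 4 * triple b.rank P₁.rank P₂.rank + 4

/-- Uniqueness of the shell of a number, for a sequence of shells with sizes `g`. -/
theorem shell_unique {f g : ℕ → ℕ} (hf : ∀ n, f (n + 1) = f n + g n) {s s' r r' : ℕ}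
    (hr : r < g s) (hr' : r' < g s') (h : r + f s = r' + f s') : s = s' ∧ r = r' := by
  have mono : Monotone f := monotone_nat_of_le_succ fun n => by rw [hf]; omega
  have hs : s = s' := by
    rcases Nat.lt_trichotomy s s' with h1 | h1 | h1
    · have := mono (Nat.succ_le_of_lt h1)
      have := hf s
      simp only [Nat.succ_eq_add_one] at *
      omega
    · exact h1
    · have := mono (Nat.succ_le_of_lt h1)
      have := hf s'
      simp only [Nat.succ_eq_add_one] at *
      omega
  subst hs
  exact ⟨rfl, by omega⟩

/-- Existence of the shell of a number. -/
theorem shell_exists {f g : ℕ → ℕ} (hf : ∀ n, f (n + 1) = f n + g n) (h0 : f 0 = 0)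
    (hg : ∀ n, 0 < g n) (n : ℕ) : ∃ s r, r < g s ∧ r + f s = n := by
  induction n with
  | zero => exact ⟨0, 0, hg 0, by omega⟩
  | succ n ih =>
    obtain ⟨s, r, hr, h⟩ := ih
    by_cases hlt : r + 1 < g s
    · exact ⟨s, r + 1, hlt, by omega⟩
    · exact ⟨s + 1, 0, hg _, by rw [hf]; omega⟩

theorem choose_two_step (n : ℕ) : (n + 1 + 1).choose 2 = (n + 1).choose 2 + (n + 1) := by
  rw [Nat.choose_succ_succ' (n + 1) 1, Nat.choose_one_right, Nat.add_comm]

theorem choose_three_step (n : ℕ) :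
    (n + 1 + 2).choose 3 = (n + 2).choose 3 + (n + 2).choose 2 := by
  rw [Nat.choose_succ_succ' (n + 2) 2, Nat.add_comm]

theorem pair_inj {x y x' y' : ℕ} (h : pair x y = pair x' y') : x = x' ∧ y = y' := by
  have := shell_unique (f := fun n => (n + 1).choose 2) (g := fun n => n + 1) choose_two_step
    (s := x + y) (s' := x' + y') (r := x) (r' := x') (by simp) (by simp) h
  omega

theorem pair_surj (n : ℕ) : ∃ x y, pair x y = n := by
  obtain ⟨s, r, hr, h⟩ := shell_exists (f := fun n => (n + 1).choose 2) (g := fun n => n + 1)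
    choose_two_step (by simp) (by simp) n
  refine ⟨r, s - r, ?_⟩
  rw [pair, show r + (s - r) = s by omega]
  exact h

theorem pair_lt (x y z : ℕ) : pair x y < (x + y + z + 2).choose 2 := by
  have h1 : pair x y < (x + y + 2).choose 2 := by
    have h2 : (x + y + 2).choose 2 = _ := choose_two_step (x + y)
    simp only [pair]
    omega
  exact h1.trans_le (Nat.choose_le_choose 2 (by omega))

theorem triple_inj {x y z x' y' z' : ℕ} (h : triple x y z = triple x' y' z') :
    x = x' ∧ y = y' ∧ z = z' := by
  have := shell_unique (f := fun n => (n + 2).choose 3) (g := fun n => (n + 2).choose 2)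
    choose_three_step (s := x + y + z) (s' := x' + y' + z') (pair_lt x y z) (pair_lt x' y' z') h
  have := pair_inj this.2
  omega

theorem triple_surj (n : ℕ) : ∃ x y z, triple x y z = n := by
  obtain ⟨s, r, hr, h⟩ := shell_exists (f := fun n => (n + 2).choose 3)
    (g := fun n => (n + 2).choose 2) choose_three_step (by simp)
    (fun n => Nat.choose_pos (by omega)) n
  obtain ⟨x, y, rfl⟩ := pair_surj r
  have hle : x + y ≤ s := by
    by_contra hlt
    have h1 : (s + 2).choose 2 ≤ (x + y + 1).choose 2 := Nat.choose_le_choose 2 (by omega)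
    simp only [pair] at hr
    omega
  refine ⟨x, y, s - (x + y), ?_⟩
  rw [triple, show x + y + (s - (x + y)) = s by omega]
  exact h

theorem le_pair (x y : ℕ) : x ≤ pair x y ∧ y ≤ pair x y := by
  have h : (x + y + 1).choose 2 = (x + y).choose 1 + (x + y).choose 2 :=
    Nat.choose_succ_succ' (x + y) 1
  rw [Nat.choose_one_right] at h
  simp only [pair]
  omega

theorem le_triple (x y z : ℕ) : x ≤ triple x y z ∧ y ≤ triple x y z ∧ z ≤ triple x y z := by
  have h := le_pair x y
  have h2 : (x + y + z + 2).choose 3 = (x + y + z + 1).choose 2 + (x + y + z + 1).choose 3 :=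
    Nat.choose_succ_succ' (x + y + z + 1) 2
  have h3 : (x + y + z + 1).choose 2 = (x + y + z).choose 1 + (x + y + z).choose 2 :=
    Nat.choose_succ_succ' (x + y + z) 1
  rw [Nat.choose_one_right] at h3
  simp only [pair] at h
  simp only [triple]
  omega

theorem cancel {k c u v : ℕ} (hk : 0 < k) (h : k * u + c = k * v + c) : u = v :=
  Nat.eq_of_mul_eq_mul_left hk (Nat.add_right_cancel h)

theorem AExp.rank_injective : Function.Injective AExp.rank := by
  intro a
  induction a with
  | readbit => intro a' h; cases a' <;> simp only [rank] at h <;> first | rfl | omega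
  | num n => intro a' h; cases a' <;> simp only [rank] at h <;> first | omega | (congr 1; omega)
  | loc n => intro a' h; cases a' <;> simp only [rank] at h <;> first | omega | (congr 1; omega)
  | add a₁ a₂ ih₁ ih₂ | sub a₁ a₂ ih₁ ih₂ | mul a₁ a₂ ih₁ ih₂ =>
    intro a' h
    cases a' <;> simp only [rank] at h <;> first
      | omega
      | (have h' := pair_inj (cancel (by norm_num) h)
         rw [ih₁ h'.1, ih₂ h'.2])

theorem BExp.rank_injective : Function.Injective BExp.rank := by
  intro b
  induction b with
  | tt => intro b' h; cases b' <;> simp only [rank] at h <;> first | rfl | omega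
  | ff => intro b' h; cases b' <;> simp only [rank] at h <;> first | rfl | omega
  | eq a₁ a₂ | lt a₁ a₂ =>
    intro b' h
    cases b' <;> simp only [rank] at h <;> first
      | omega
      | (have h' := pair_inj (cancel (by norm_num) h)
         rw [AExp.rank_injective h'.1, AExp.rank_injective h'.2])
  | and b₁ b₂ ih₁ ih₂ | or b₁ b₂ ih₁ ih₂ =>
    intro b' h
    cases b' <;> simp only [rank] at h <;> first
      | omega
      | (have h' := pair_inj (cancel (by norm_num) h)
         rw [ih₁ h'.1, ih₂ h'.2])
  | not b ih =>
    intro b' h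
    cases b' <;> simp only [rank] at h <;> first
      | omega
      | (rw [ih (cancel (by norm_num) h)])

theorem Sentence.rank_injective : Function.Injective Sentence.rank := by
  intro P
  induction P with
  | skip => intro P' h; cases P' <;> simp only [rank] at h <;> first | rfl | omega
  | assign n a =>
    intro P' h
    cases P' <;> simp only [rank] at h <;> first
      | omega
      | (have h' := pair_inj (cancel (by norm_num) h)
         rw [h'.1, AExp.rank_injective h'.2])
  | whileDo b P ih =>
    intro P' h
    cases P' <;> simp only [rank] at h <;> first
      | omega
      | (have h' := pair_inj (cancel (by norm_num) h)
         rw [BExp.rank_injective h'.1, ih h'.2])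
  | seq P₁ P₂ ih₁ ih₂ =>
    intro P' h
    cases P' <;> simp only [rank] at h <;> first
      | omega
      | (have h' := pair_inj (cancel (by norm_num) h)
         rw [ih₁ h'.1, ih₂ h'.2])
  | ite b P₁ P₂ ih₁ ih₂ =>
    intro P' h
    cases P' <;> simp only [rank] at h <;> first
      | omega
      | (have h' := triple_inj (cancel (by norm_num) h)
         rw [BExp.rank_injective h'.1, ih₁ h'.2.1, ih₂ h'.2.2])

theorem AExp.rank_surjective : Function.Surjective AExp.rank := by
  intro k
  induction k using Nat.strong_induction_on with
  | _ k ih =>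
    rcases Nat.eq_zero_or_pos k with rfl | hk
    · exact ⟨readbit, rfl⟩
    · obtain ⟨x, y, hxy⟩ := pair_surj ((k - 1) / 5)
      have hle := le_pair x y
      have h5 : (k - 1) % 5 = 0 ∨ (k - 1) % 5 = 1 ∨ (k - 1) % 5 = 2 ∨ (k - 1) % 5 = 3 ∨
        (k - 1) % 5 = 4 := by omega
      rcases h5 with h | h | h | h | h
      · exact ⟨num ((k - 1) / 5), by simp only [rank]; omega⟩
      · exact ⟨loc ((k - 1) / 5), by simp only [rank]; omega⟩
      all_goals
        obtain ⟨a₁, h₁⟩ := ih x (by omega)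
        obtain ⟨a₂, h₂⟩ := ih y (by omega)
      · exact ⟨add a₁ a₂, by simp only [rank, h₁, h₂]; omega⟩
      · exact ⟨sub a₁ a₂, by simp only [rank, h₁, h₂]; omega⟩
      · exact ⟨mul a₁ a₂, by simp only [rank, h₁, h₂]; omega⟩

theorem BExp.rank_surjective : Function.Surjective BExp.rank := by
  intro k
  induction k using Nat.strong_induction_on with
  | _ k ih =>
    rcases Nat.lt_or_ge k 2 with hk | hk
    · rcases (show k = 0 ∨ k = 1 by omega) with rfl | rfl
      · exact ⟨tt, rfl⟩
      · exact ⟨ff, rfl⟩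
    · obtain ⟨x, y, hxy⟩ := pair_surj ((k - 2) / 5)
      have hle := le_pair x y
      obtain ⟨c₁, e₁⟩ := AExp.rank_surjective x
      obtain ⟨c₂, e₂⟩ := AExp.rank_surjective y
      obtain ⟨b₁, h₁⟩ := ih x (by omega)
      obtain ⟨b₂, h₂⟩ := ih y (by omega)
      have h5 : (k - 2) % 5 = 0 ∨ (k - 2) % 5 = 1 ∨ (k - 2) % 5 = 2 ∨ (k - 2) % 5 = 3 ∨
        (k - 2) % 5 = 4 := by omega
      rcases h5 with h | h | h | h | h
      · exact ⟨eq c₁ c₂, by simp only [rank, e₁, e₂]; omega⟩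
      · exact ⟨lt c₁ c₂, by simp only [rank, e₁, e₂]; omega⟩
      · exact ⟨and b₁ b₂, by simp only [rank, h₁, h₂]; omega⟩
      · exact ⟨or b₁ b₂, by simp only [rank, h₁, h₂]; omega⟩
      · obtain ⟨b, hb⟩ := ih ((k - 2) / 5) (by omega)
        exact ⟨not b, by simp only [rank, hb]; omega⟩

theorem Sentence.rank_surjective : Function.Surjective Sentence.rank := by
  intro k
  induction k using Nat.strong_induction_on with
  | _ k ih =>
    rcases Nat.eq_zero_or_pos k with rfl | hk
    · exact ⟨skip, rfl⟩
    · obtain ⟨x, y, hxy⟩ := pair_surj ((k - 1) / 4)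
      have hle := le_pair x y
      obtain ⟨a, ha⟩ := AExp.rank_surjective y
      obtain ⟨b, hb⟩ := BExp.rank_surjective x
      obtain ⟨P₁, h₁⟩ := ih x (by omega)
      obtain ⟨P₂, h₂⟩ := ih y (by omega)
      have h4 : (k - 1) % 4 = 0 ∨ (k - 1) % 4 = 1 ∨ (k - 1) % 4 = 2 ∨ (k - 1) % 4 = 3 := by
        omega
      rcases h4 with h | h | h | h
      · exact ⟨assign x a, by simp only [rank, ha]; omega⟩
      · exact ⟨.whileDo b P₂, by simp only [rank, hb, h₂]; omega⟩
      · exact ⟨seq P₁ P₂, by simp only [rank, h₁, h₂]; omega⟩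
      · obtain ⟨u, v, w, huvw⟩ := triple_surj ((k - 1) / 4)
        have hle' := le_triple u v w
        obtain ⟨c, hc⟩ := BExp.rank_surjective u
        obtain ⟨Q₁, e₁⟩ := ih v (by omega)
        obtain ⟨Q₂, e₂⟩ := ih w (by omega)
        exact ⟨ite c Q₁ Q₂, by simp only [rank, hc, e₁, e₂]; omega⟩

/-- The `n`-th sentence `P_n` in the enumeration of all sentences. -/
noncomputable def sentence : ℕ ≃ Sentence :=
  (Equiv.ofBijective Sentence.rank ⟨Sentence.rank_injective, Sentence.rank_surjective⟩).symm

/-! ### The machine -/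

theorem bstr_injective : Function.Injective bstr := by
  intro m
  induction m using Nat.strong_induction_on with
  | _ m ih =>
    intro n h
    cases m with
    | zero => cases n with
      | zero => rfl
      | succ n => simp [bstr] at h
    | succ m => cases n with
      | zero => simp [bstr] at h
      | succ n =>
        rw [bstr, bstr] at h
        obtain ⟨h1, h2⟩ := List.append_inj' h rfl
        have h3 := ih (m / 2) (by omega) h1
        simp only [List.cons.injEq, and_true, decide_eq_decide] at h2
        omega

theorem replicate_inj {k l : ℕ} {u v : List Bool}
    (h : List.replicate k true ++ false :: u = List.replicate l true ++ false :: v) :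
    k = l ∧ u = v := by
  induction k generalizing l with
  | zero => cases l with
    | zero => simpa using h
    | succ l => simp [List.replicate_succ] at h
  | succ k ih => cases l with
    | zero => simp [List.replicate_succ] at h
    | succ l =>
      simp only [List.replicate_succ, List.cons_append, List.cons.injEq, true_and] at h
      have := ih h
      exact ⟨by omega, this.2⟩

theorem twoPart_inj {m n : ℕ} {y z : List Bool} (h : twoPart m y = twoPart n z) :
    m = n ∧ y = z := by
  simp only [twoPart, selfDelim, List.append_assoc, List.cons_append] at h
  obtain ⟨h1, h2⟩ := replicate_inj h
  obtain ⟨h3, h4⟩ := List.append_inj h2 h1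
  exact ⟨bstr_injective h3, h4⟩

/-- The machine IMP2 halts on the input `p` with output `x`: `p` is a two-part code `⟨n, y⟩`, and
the sentence `P_n`, executed with input stream `y`, halts after reading exactly all the bits of
`y`, with output `x`. -/
def Outputs (p x : List Bool) : Prop :=
  ∃ (n : ℕ) (y : List Bool), p = twoPart n y ∧ (sentence n).Outputs y x

theorem Outputs.unique {p x x' : List Bool} (h : Outputs p x) (h' : Outputs p x') :
    x = x' := by
  obtain ⟨n, y, rfl, h⟩ := h
  obtain ⟨n', y', e, h'⟩ := h'
  obtain ⟨rfl, rfl⟩ := twoPart_inj e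
  exact h.unique h'

/-- The machine IMP2, as a partial function on binary strings. -/
noncomputable def machine : List Bool →. List Bool :=
  fun p => ⟨∃ x, Outputs p x, fun h => h.choose⟩

theorem mem_machine {p x : List Bool} : x ∈ machine p ↔ Outputs p x :=
  ⟨fun ⟨h, e⟩ => e ▸ h.choose_spec, fun h => ⟨⟨x, h⟩, Exists.choose_spec ⟨x, h⟩ |>.unique h⟩⟩

end Imp2

/-! ### Prefix machines and prefix complexity -/

/-- A prefix machine: a partial computable function on binary strings whose domain, the set of
halting programs, is prefix-free. -/
structure IsPrefixMachine (G : List Bool →. List Bool) : Prop where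
  partrec : Partrec G
  prefixFree : ∀ p ∈ G.Dom, ∀ q ∈ G.Dom, p <+: q → p = q

/-- The complexity `K_U(x) = min {|p| : U(p) = x}`, equal to `∞` if `U` has no program for `x`. -/
noncomputable def complexity (U : List Bool →. List Bool) (x : List Bool) : ℕ∞ :=
  ⨅ (p : List Bool) (_ : x ∈ U p), (p.length : ℕ∞)

/-- `U` is additively optimal for the class `C` of machines: it belongs to `C`, and for every
machine `G` in `C` there is a constant `c` with `K_U(x) ≤ K_G(x) + c` for all `x`. -/
def AdditivelyOptimal (U : List Bool →. List Bool) (C : Set (List Bool →. List Bool)) : Prop :=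
  U ∈ C ∧ ∀ G ∈ C, ∃ c : ℕ, ∀ x : List Bool, complexity U x ≤ complexity G x + c

/-!
`readbit` consumes the input bit by bit, so a halting execution is unaffected by bits appended to
the input. As the code of `n` delimits itself, two halting programs of which one is a prefix of the
other must therefore read the same bits, and IMP2 is prefix-free.

Conversely, let `G` be a prefix machine. Having consumed `u`, a sentence can search for an
extension of `u` in the domain of `G`. Prefix-freeness makes the first find decisive: if it is `u`
itself then no other extension of `u` is in the domain and the output is `G u`, and otherwise `u`
is not in the domain and it is safe to read another bit. The step of this search is primitive
recursive, hence computed by a sentence built by recursion on its definition, and the search is a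
single `while` loop around it.

That IMP2 is computable follows from an interpreter whose configurations consist of a stack of
sentences still to be executed, a finite list of memory contents and the unread input.
-/

namespace Imp2

/-! ### Prefix-freeness -/

/-- The state `s` with the bits `z` appended to the unread input. Halting executions are stable
under such extensions. -/
def State.extend (s : State) (z : List Bool) : State := ⟨s.mem, s.input ++ z⟩

theorem AExp.eval_extend {a : AExp} {s t : State} {v : ℕ} (h : a.eval s = some (v, t))
    (z : List Bool) : a.eval (s.extend z) = some (v, t.extend z) := by
  induction a generalizing s t v with
  | readbit =>
    obtain ⟨σ, _ | ⟨d, y⟩⟩ := s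
    · cases h
    · obtain ⟨rfl, rfl⟩ : d.toNat = v ∧ (⟨σ, y⟩ : State) = t := by simpa [AExp.eval] using h
      rfl
  | num n | loc n =>
    simp only [AExp.eval, Option.some.injEq, Prod.mk.injEq] at h ⊢
    obtain ⟨rfl, rfl⟩ := h
    exact ⟨rfl, rfl⟩
  | add a₁ a₂ ih₁ ih₂ | sub a₁ a₂ ih₁ ih₂ | mul a₁ a₂ ih₁ ih₂ =>
    simp only [AExp.eval, Option.bind_eq_bind, Option.bind_eq_some_iff, Prod.exists,
      Option.pure_def, Option.some.injEq, Prod.mk.injEq] at h ⊢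
    obtain ⟨v₁, s₁, h₁, v₂, s₂, h₂, rfl, rfl⟩ := h
    exact ⟨v₁, _, ih₁ h₁, v₂, _, ih₂ h₂, rfl, rfl⟩

theorem BExp.eval_extend {b : BExp} {s t : State} {c : Bool} (h : b.eval s = some (c, t))
    (z : List Bool) : b.eval (s.extend z) = some (c, t.extend z) := by
  induction b generalizing s t c with
  | tt | ff =>
    simp only [BExp.eval, Option.some.injEq, Prod.mk.injEq] at h ⊢
    obtain ⟨rfl, rfl⟩ := h
    exact ⟨rfl, rfl⟩
  | eq a₁ a₂ | lt a₁ a₂ =>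
    simp only [BExp.eval, Option.bind_eq_bind, Option.bind_eq_some_iff, Prod.exists,
      Option.pure_def, Option.some.injEq, Prod.mk.injEq] at h ⊢
    obtain ⟨v₁, s₁, h₁, v₂, s₂, h₂, rfl, rfl⟩ := h
    exact ⟨v₁, _, AExp.eval_extend h₁ z, v₂, _, AExp.eval_extend h₂ z, rfl, rfl⟩
  | and b₁ b₂ ih₁ ih₂ | or b₁ b₂ ih₁ ih₂ =>
    simp only [BExp.eval, Option.bind_eq_bind, Option.bind_eq_some_iff, Prod.exists] at h ⊢
    obtain ⟨c₁, s₁, h₁, h⟩ := h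
    refine ⟨c₁, _, ih₁ h₁, ?_⟩
    cases c₁
    all_goals
      simp only [Bool.false_eq_true, if_false, if_true, Option.pure_def, Option.some.injEq,
        Prod.mk.injEq] at h ⊢
      first
        | exact ih₂ h
        | exact ⟨h.1, congrArg (State.extend · z) h.2⟩
  | not b ih =>
    simp only [BExp.eval, Option.bind_eq_bind, Option.bind_eq_some_iff, Prod.exists,
      Option.pure_def, Option.some.injEq, Prod.mk.injEq] at h ⊢
    obtain ⟨c₁, s₁, h₁, rfl, rfl⟩ := h
    exact ⟨c₁, _, ih h₁, rfl, rfl⟩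

theorem Exec.extend {P : Sentence} {s t : State} (h : Exec P s t) (z : List Bool) :
    Exec P (s.extend z) (t.extend z) := by
  induction h with
  | skip => exact .skip _
  | assign ha => exact .assign (AExp.eval_extend ha z)
  | while_true hb _ _ ih₁ ih₂ => exact .while_true (BExp.eval_extend hb z) ih₁ ih₂
  | while_false hb => exact .while_false (BExp.eval_extend hb z)
  | seq _ _ ih₁ ih₂ => exact .seq ih₁ ih₂
  | ite_true hb _ ih => exact .ite_true (BExp.eval_extend hb z) ih
  | ite_false hb _ ih => exact .ite_false (BExp.eval_extend hb z) ih

theorem machine_prefixFree : ∀ p ∈ machine.Dom, ∀ q ∈ machine.Dom, p <+: q → p = q := by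
  rintro _ ⟨x, n, y, rfl, σ, hexec, -⟩ _ ⟨x', n', y', rfl, σ', hexec', -⟩ ⟨z, hz⟩
  have hz' : twoPart n (y ++ z) = twoPart n' y' := by
    rw [← hz, twoPart, twoPart, List.append_assoc]
  obtain ⟨rfl, rfl⟩ := twoPart_inj hz'
  have hend := congrArg State.input ((hexec.extend z).det hexec')
  obtain rfl : z = [] := by simpa [State.extend] using hend
  rw [List.append_nil]

theorem machine_twoPart (n : ℕ) (y : List Bool) :
    machine (twoPart n y) = (sentence n).run y := by
  ext x
  rw [mem_machine, Sentence.mem_run]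
  constructor
  · rintro ⟨n', y', heq, h⟩
    obtain ⟨rfl, rfl⟩ := twoPart_inj heq
    exact h
  · exact fun h => ⟨n, y, rfl, h⟩

theorem length_twoPart (n : ℕ) (y : List Bool) :
    (twoPart n y).length = y.length + (2 * (bstr n).length + 1) := by
  simp only [twoPart, selfDelim, List.length_append, List.length_replicate, List.length_cons]
  omega

theorem complexity_machine_le {G : List Bool →. List Bool} {n : ℕ}
    (h : ∀ y, (sentence n).run y = G y) (x : List Bool) :
    complexity machine x ≤ complexity G x + (2 * (bstr n).length + 1 : ℕ) := by
  simp only [complexity, ENat.iInf_add]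
  refine le_iInf₂ fun y hy => ?_
  rw [← h, ← machine_twoPart] at hy
  exact (iInf₂_le (twoPart n y) hy).trans_eq (by rw [length_twoPart, Nat.cast_add])

/-! ### Computable functions -/

section Computability

variable {α β σ : Type*} [Primcodable α] [Primcodable β] [Primcodable σ]

theorem exists_partrec_inverse {f : α → β} (hf : Computable f) (hinj : Function.Injective f) :
    ∃ g : β →. α, Partrec g ∧ ∀ b a, a ∈ g b ↔ f a = b := by
  classical
  let test : β → α → Option α := fun b a =>
    bif decide (Encodable.encode (f a) = Encodable.encode b) then some a else none
  have htest : ∀ b a a', test b a = some a' ↔ a = a' ∧ f a' = b := by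
    intro b a a'
    by_cases h : f a = b <;> simp +contextual only [test, h, Encodable.encode_inj, decide_true,
      decide_false, cond_true, cond_false, Option.some.injEq, reduceCtorEq, false_iff, not_and,
      iff_self_and] <;> (rintro rfl; exact h)
  have htest_comp : Computable₂ test :=
    Computable.cond
      (Primrec.eq.decide.to_comp.comp (Computable.encode.comp (hf.comp Computable.snd))
        (Computable.encode.comp Computable.fst))
      (Computable.option_some.comp Computable.snd) (Computable.const none)
  let search : β → ℕ → Option α := fun b k => (Encodable.decode k).bind (test b)
  have hsearch : ∀ b a, (∃ k, search b k = some a) ↔ f a = b := by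
    intro b a
    simp only [search, Option.bind_eq_some_iff, htest]
    constructor
    · rintro ⟨k, _, -, -, h⟩
      exact h
    · exact fun h => ⟨Encodable.encode a, a, Encodable.encodek a, rfl, h⟩
  refine ⟨fun b => Nat.rfindOpt (search b), Partrec.rfindOpt
    (Computable.option_bind (Computable.decode.comp Computable.snd)
      (htest_comp.comp (Computable.fst.comp Computable.fst) Computable.snd)), fun b a => ?_⟩
  have hspec : ∀ a', a' ∈ Nat.rfindOpt (search b) → f a' = b := fun a' h =>
    (hsearch b a').1 (Nat.rfindOpt_spec h)
  refine ⟨hspec a, fun h => ?_⟩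
  obtain ⟨k, hk⟩ := (hsearch b a).2 h
  have hdom : (Nat.rfindOpt (search b)).Dom := Nat.rfindOpt_dom.2 ⟨k, a, hk⟩
  rw [← hinj ((hspec _ (Part.get_mem hdom)).trans h.symm)]
  exact Part.get_mem hdom

theorem computable_symm (e : α ≃ β) (he : Computable e) : Computable e.symm := by
  obtain ⟨g, hg, hmem⟩ := exists_partrec_inverse he e.injective
  exact hg.of_eq_tot fun b => (hmem b _).2 (e.apply_symm_apply b)

theorem exists_primrec_enum {G : α →. σ} (hG : Partrec G) :
    ∃ T : α → ℕ → Option σ, Primrec₂ T ∧ ∀ a x, x ∈ G a ↔ ∃ k, T a k = some x := by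
  obtain ⟨c, hc⟩ := Nat.Partrec.Code.exists_code.1 hG
  have hmem : ∀ a r, r ∈ c.eval (Encodable.encode a) ↔ ∃ x ∈ G a, Encodable.encode x = r := by
    simp [hc]
  refine ⟨fun a k => (Nat.Partrec.Code.evaln k c (Encodable.encode a)).bind Encodable.decode,
    Primrec.option_bind
      (Nat.Partrec.Code.primrec_evaln.comp
        ((Primrec.snd.pair (Primrec.const c)).pair (Primrec.encode.comp Primrec.fst)))
      (Primrec.decode.comp Primrec.snd).to₂, fun a x => ⟨fun hx => ?_, ?_⟩⟩
  · obtain ⟨k, hk⟩ := Nat.Partrec.Code.evaln_complete.1 ((hmem a _).2 ⟨x, hx, rfl⟩)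
    exact ⟨k, by simp [Option.mem_def.1 hk]⟩
  · rintro ⟨k, hk⟩
    obtain ⟨r, hr, hx⟩ := Option.bind_eq_some_iff.1 hk
    obtain ⟨x', hx', rfl⟩ := (hmem a r).1 (Nat.Partrec.Code.evaln_complete.2 ⟨k, hr⟩)
    rw [Encodable.encodek, Option.some.injEq] at hx
    exact hx ▸ hx'

theorem computable_list_foldl {f : α → List β} {g : α → σ} {h : α → σ × β → σ}
    (hf : Computable f) (hg : Computable g) (hh : Computable₂ h) :
    Computable fun a => (f a).foldl (fun s b => h a (s, b)) (g a) := by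
  have htake : Computable₂ fun a n => ((f a).take n).foldl (fun s b => h a (s, b)) (g a) := by
    have hstep : Computable₂ fun (a : α) (p : ℕ × σ) =>
        (f a)[p.1]?.elim p.2 fun b => h a (p.2, b) :=
      (Computable.option_casesOn
        (Computable.list_getElem?.comp (hf.comp Computable.fst)
          (Computable.fst.comp Computable.snd))
        (Computable.snd.comp Computable.snd)
        (hh.comp (Computable.fst.comp Computable.fst)
          ((Computable.snd.comp (Computable.snd.comp Computable.fst)).pair
            Computable.snd)).to₂).of_eq fun p => by
            cases h : (f p.1)[p.2.1]? <;> simp only [h, Option.elim]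
    refine (Computable.nat_rec Computable.snd (hg.comp Computable.fst)
      (hstep.comp (Computable.fst.comp Computable.fst) Computable.snd).to₂).of_eq fun p => ?_
    obtain ⟨a, n⟩ := p
    induction n with
    | zero => rfl
    | succ n ih =>
      simp only [List.take_add_one, List.foldl_append] at ih ⊢
      rw [← ih]
      rcases (f a)[n]? <;> rfl
  exact (htake.comp Computable.id (Computable.list_length.comp hf)).of_eq fun a => by
    rw [id_eq, List.take_length]

theorem computable₂_sum_elim {γ : Type*} [Primcodable γ] {g : α → β → σ} {h : α → γ → σ}
    (hg : Computable₂ g) (hh : Computable₂ h) :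
    Computable₂ fun a => Sum.elim (g a) (h a) :=
  (Computable.sumCasesOn Computable.snd
    (hg.comp (Computable.fst.comp Computable.fst) Computable.snd).to₂
    (hh.comp (Computable.fst.comp Computable.fst) Computable.snd).to₂).of_eq fun p => by
      rcases p.2 with _ | _ <;> rfl

theorem partrec_stateTransition_eval {f : α → Option α} (hf : Computable f) :
    Partrec (StateTransition.eval f) :=
  Partrec.fix <| (Computable.option_casesOn hf (Computable.sumInl.comp .id)
    (Computable.sumInr.comp .snd).to₂).of_eq fun a => by
      cases f a <;> rfl

end Computability

/-! ### Primitive recursive functions as sentences -/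

/-- The position in the enumeration `bstr` of the string obtained from `bstr n` by appending the
bits of `w`. In particular `bappend 0` is the inverse of `bstr`. -/
def bappend (n : ℕ) (w : List Bool) : ℕ := w.foldl (fun m d => 2 * m + 1 + d.toNat) n

theorem bstr_append_bit (n : ℕ) (d : Bool) : bstr (2 * n + 1 + d.toNat) = bstr n ++ [d] := by
  cases d
  · simp [bstr]
  · rw [Bool.toNat_true, bstr, show (2 * n + 1) / 2 = n by omega]
    simp

theorem bstr_bappend (n : ℕ) (w : List Bool) : bstr (bappend n w) = bstr n ++ w := by
  induction w generalizing n with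
  | nil => simp [bappend]
  | cons d w ih =>
    have h := ih (2 * n + 1 + d.toNat)
    rw [bstr_append_bit] at h
    simpa [bappend] using h

theorem bstr_bappend_zero (w : List Bool) : bstr (bappend 0 w) = w := by
  rw [bstr_bappend, bstr_zero, List.nil_append]

theorem primrec_bappend : Primrec₂ bappend :=
  Primrec.list_foldl (h := fun (_ : ℕ × List Bool) (p : ℕ × Bool) => 2 * p.1 + 1 + p.2.toNat)
    Primrec.snd Primrec.fst (Primrec.nat_add.comp
      (Primrec.nat_double_succ.comp (Primrec.fst.comp Primrec.snd))
      ((Primrec.dom_bool Bool.toNat).comp (Primrec.snd.comp Primrec.snd)))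

theorem computable_bstr : Computable bstr :=
  computable_symm ⟨bappend 0, bstr, bstr_bappend_zero,
    fun n => bstr_injective (bstr_bappend_zero (bstr n))⟩
    (primrec_bappend.comp (Primrec.const 0) Primrec.id).to_comp

theorem computable_twoPart : Computable₂ twoPart := by
  have hreplicate : Computable fun n : ℕ => List.replicate n true :=
    (Primrec.list_map Primrec.list_range (Primrec.const true).to₂).to_comp.of_eq fun n => by
      simp [List.map_const']
  have hselfDelim : Computable selfDelim :=
    Computable.list_append.comp (hreplicate.comp (Computable.list_length.comp computable_bstr))
      (Computable.list_cons.comp (Computable.const false) computable_bstr)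
  exact Computable.list_append.comp (hselfDelim.comp Computable.fst) Computable.snd

/-- A bound on the locations that a sentence may change: those from `P.bound` on keep their
contents. -/
def Sentence.bound : Sentence → ℕ
  | skip => 0
  | assign n _ => n + 1
  | .whileDo _ P => P.bound
  | seq P₁ P₂ => max P₁.bound P₂.bound
  | ite _ P₁ P₂ => max P₁.bound P₂.bound

theorem AExp.eval_mem {a : AExp} {s t : State} {v : ℕ} (h : a.eval s = some (v, t)) :
    t.mem = s.mem := by
  induction a generalizing s t v with
  | readbit =>
    rcases s with ⟨σ, _ | ⟨d, y⟩⟩ <;>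
      simp only [AExp.eval, reduceCtorEq, Option.some.injEq, Prod.mk.injEq] at h
    rw [← h.2]
  | num n | loc n => simp_all [AExp.eval]
  | add a₁ a₂ ih₁ ih₂ | sub a₁ a₂ ih₁ ih₂ | mul a₁ a₂ ih₁ ih₂ =>
    simp only [AExp.eval, Option.bind_eq_bind, Option.bind_eq_some_iff, Prod.exists,
      Option.pure_def, Option.some.injEq, Prod.mk.injEq] at h
    obtain ⟨v₁, s₁, h₁, v₂, s₂, h₂, -, rfl⟩ := h
    rw [ih₂ h₂, ih₁ h₁]

theorem BExp.eval_mem {b : BExp} {s t : State} {v : Bool} (h : b.eval s = some (v, t)) :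
    t.mem = s.mem := by
  induction b generalizing s t v with
  | tt | ff => simp_all [BExp.eval]
  | eq a₁ a₂ | lt a₁ a₂ =>
    simp only [BExp.eval, Option.bind_eq_bind, Option.bind_eq_some_iff, Prod.exists,
      Option.pure_def, Option.some.injEq, Prod.mk.injEq] at h
    obtain ⟨v₁, s₁, h₁, v₂, s₂, h₂, -, rfl⟩ := h
    rw [AExp.eval_mem h₂, AExp.eval_mem h₁]
  | and b₁ b₂ ih₁ ih₂ | or b₁ b₂ ih₁ ih₂ =>
    simp only [BExp.eval, Option.bind_eq_bind, Option.bind_eq_some_iff, Prod.exists] at h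
    obtain ⟨v₁, s₁, h₁, h⟩ := h
    rw [← ih₁ h₁]
    cases v₁
    all_goals
      simp only [Bool.false_eq_true, if_false, if_true, Option.pure_def, Option.some.injEq,
        Prod.mk.injEq] at h
      first
        | exact ih₂ h
        | rw [h.2]
  | not b ih =>
    simp only [BExp.eval, Option.bind_eq_bind, Option.bind_eq_some_iff, Prod.exists,
      Option.pure_def, Option.some.injEq, Prod.mk.injEq] at h
    obtain ⟨v₁, s₁, h₁, -, rfl⟩ := h
    exact ih h₁

theorem Exec.mem_eq_of_bound_le {P : Sentence} {s t : State} (h : Exec P s t) {i : ℕ}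
    (hi : P.bound ≤ i) : t.mem i = s.mem i := by
  induction h with
  | skip => rfl
  | assign ha =>
    rw [← AExp.eval_mem ha]
    exact Function.update_of_ne (Nat.lt_of_succ_le hi).ne' _ _
  | while_true hb _ _ ih₁ ih₂ => rw [ih₂ hi, ih₁ hi, BExp.eval_mem hb]
  | while_false hb => rw [BExp.eval_mem hb]
  | seq _ _ ih₁ ih₂ => rw [ih₂ (le_of_max_le_right hi), ih₁ (le_of_max_le_left hi)]
  | ite_true hb _ ih => rw [ih (le_of_max_le_left hi), BExp.eval_mem hb]
  | ite_false hb _ ih => rw [ih (le_of_max_le_right hi), BExp.eval_mem hb]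

theorem exec_assign {a : AExp} {σ : ℕ → ℕ} {y z : List Bool} {v : ℕ} (n : ℕ)
    (h : a.eval ⟨σ, y⟩ = some (v, ⟨σ, z⟩)) :
    Exec (.assign n a) ⟨σ, y⟩ ⟨Function.update σ n v, z⟩ :=
  .assign h

/-- The sentence that sets `x[1], …, x[n]` to `0`, leaving `x[0]` as the only output. -/
def clear : ℕ → Sentence
  | 0 => .skip
  | n + 1 => .seq (clear n) (.assign (n + 1) (.num 0))

theorem exec_clear (n : ℕ) (σ : ℕ → ℕ) (y : List Bool) :
    Exec (clear n) ⟨σ, y⟩ ⟨fun i => if 0 < i ∧ i ≤ n then 0 else σ i, y⟩ := by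
  induction n with
  | zero =>
    have h : (fun i => if 0 < i ∧ i ≤ 0 then 0 else σ i) = σ := by
      ext i
      exact if_neg (by omega)
    rw [h]
    exact .skip _
  | succ n ih =>
    have h : (fun i => if 0 < i ∧ i ≤ n + 1 then 0 else σ i) =
        Function.update (fun i => if 0 < i ∧ i ≤ n then 0 else σ i) (n + 1) 0 := by
      ext i
      grind [Function.update_apply]
    rw [h]
    exact ih.seq (exec_assign _ rfl)

theorem exists_outputs_iff (P : Sentence) :
    ∃ Q : Sentence, ∀ y x,
      Q.Outputs y x ↔ ∃ τ, Exec P ⟨fun _ => 0, y⟩ ⟨τ, []⟩ ∧ x = bstr (τ 0) := by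
  have houtput : ∀ {y z τ}, Exec P ⟨fun _ => 0, y⟩ ⟨τ, z⟩ →
      MemOutput (fun i => if 0 < i ∧ i ≤ P.bound then 0 else τ i) (bstr (τ 0)) := by
    intro y z τ h
    refine ⟨1, fun i hi => ite_eq_left_iff.2 fun hi' => ?_, by simp⟩
    exact h.mem_eq_of_bound_le (i := i) (by omega)
  refine ⟨.seq P (clear P.bound), fun y x => ⟨?_, ?_⟩⟩
  · rintro ⟨_, h, hx⟩
    obtain _ | _ | _ | _ | @⟨_, _, _, ⟨τ, z⟩, _, hP, hclear⟩ := h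
    have hend := (exec_clear P.bound τ z).det hclear
    simp only [State.mk.injEq] at hend
    obtain ⟨rfl, rfl⟩ := hend
    exact ⟨τ, hP, hx.unique (houtput hP)⟩
  · rintro ⟨τ, h, rfl⟩
    exact ⟨_, h.seq (exec_clear _ _ _), houtput h⟩

theorem exists_exec_for {P : Sentence} {c d m : ℕ} {I : ℕ → (ℕ → ℕ) → Prop} {y : List Bool}
    (hI : ∀ k σ, I k σ → σ c = k ∧ σ d = m)
    (hP : ∀ k < m, ∀ σ, I k σ → ∃ τ, Exec P ⟨σ, y⟩ ⟨τ, y⟩ ∧ I (k + 1) τ)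
    {k : ℕ} (hk : k ≤ m) {σ : ℕ → ℕ} (hσ : I k σ) :
    ∃ τ, Exec (.whileDo (.lt (.loc c) (.loc d)) P) ⟨σ, y⟩ ⟨τ, y⟩ ∧ I m τ := by
  have hguard : ∀ {k σ}, I k σ → BExp.eval (.lt (.loc c) (.loc d)) ⟨σ, y⟩ =
      some (decide (k < m), ⟨σ, y⟩) := by
    intro k σ h
    obtain ⟨hc, hd⟩ := hI k σ h
    simp [BExp.eval, AExp.eval, hc, hd]
  induction hk using Nat.decreasingInduction generalizing σ with
  | self => exact ⟨σ, .while_false (by simpa using hguard hσ), hσ⟩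
  | of_succ k hk ih =>
    obtain ⟨τ, hτ, hIτ⟩ := hP k hk σ hσ
    obtain ⟨ρ, hρ, hIρ⟩ := ih hIτ
    exact ⟨ρ, .while_true (by simpa [hk] using hguard hσ) hτ hρ, hIρ⟩

/-- The sentence `P` sets `x[b]` to the value of `f` at the contents of the locations `args`,
without reading input or changing a location below `b`; the locations above `b` are workspace. -/
def Realizes (P : Sentence) {n : ℕ} (args : List.Vector ℕ n) (b : ℕ)
    (f : List.Vector ℕ n → ℕ) : Prop :=
  ∀ σ y, ∃ τ, Exec P ⟨σ, y⟩ ⟨τ, y⟩ ∧ τ b = f (args.map σ) ∧ ∀ i < b, τ i = σ i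

section Realizes

variable {n : ℕ} {args : List.Vector ℕ n} {b : ℕ}

theorem map_congr_of_lt {σ τ : ℕ → ℕ} (hargs : ∀ i, args.get i < b) (h : ∀ i < b, τ i = σ i) :
    args.map τ = args.map σ :=
  List.Vector.ext fun i => by simp only [List.Vector.get_map, h _ (hargs i)]

theorem realizes_assign {a : AExp} {f : List.Vector ℕ n → ℕ}
    (ha : ∀ σ y, a.eval ⟨σ, y⟩ = some (f (args.map σ), ⟨σ, y⟩)) :
    Realizes (.assign b a) args b f := fun σ y =>
  ⟨_, exec_assign b (ha σ y), Function.update_self .., fun _ hi => Function.update_of_ne hi.ne _ _⟩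

theorem exists_realizes_all {m : ℕ} {g : Fin m → List.Vector ℕ n → ℕ}
    (hargs : ∀ i, args.get i < b)
    (hg : ∀ i c, b ≤ c → ∃ P, Realizes P args c (g i)) :
    ∃ P, ∀ σ y, ∃ τ, Exec P ⟨σ, y⟩ ⟨τ, y⟩ ∧ (∀ i : Fin m, τ (b + i) = g i (args.map σ)) ∧
      ∀ i < b, τ i = σ i := by
  induction m with
  | zero => exact ⟨.skip, fun σ y => ⟨σ, .skip _, fun i => i.elim0, fun _ _ => rfl⟩⟩
  | succ m ih =>
    obtain ⟨P, hP⟩ := ih fun i => hg i.castSucc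
    obtain ⟨Q, hQ⟩ := hg (Fin.last m) (b + m) (by omega)
    refine ⟨.seq P Q, fun σ y => ?_⟩
    obtain ⟨τ, hPτ, hτ, hτσ⟩ := hP σ y
    obtain ⟨ρ, hQρ, hρ, hρτ⟩ := hQ τ y
    refine ⟨ρ, hPτ.seq hQρ, fun i => ?_, fun i hi => ?_⟩
    · cases i using Fin.lastCases with
      | last => rw [Fin.val_last, hρ, map_congr_of_lt hargs hτσ]
      | cast i => rw [Fin.val_castSucc, hρτ _ (by omega), hτ i]
    · rw [hρτ i (by omega), hτσ i hi]

theorem exists_realizes_comp {m : ℕ} {f : List.Vector ℕ m → ℕ}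
    {g : Fin m → List.Vector ℕ n → ℕ} (hargs : ∀ i, args.get i < b)
    (hf : ∀ (args' : List.Vector ℕ m) c, (∀ i, args'.get i < c) → ∃ P, Realizes P args' c f)
    (hg : ∀ i c, b ≤ c → ∃ P, Realizes P args c (g i)) :
    ∃ P, Realizes P args b fun v => f (List.Vector.ofFn fun i => g i v) := by
  obtain ⟨P, hP⟩ := exists_realizes_all hargs hg
  obtain ⟨Q, hQ⟩ := hf (List.Vector.ofFn fun i => b + i) (b + m) (by simp)
  refine ⟨.seq P (.seq Q (.assign b (.loc (b + m)))), fun σ y => ?_⟩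
  obtain ⟨τ, hPτ, hτ, hτσ⟩ := hP σ y
  obtain ⟨ρ, hQρ, hρ, hρτ⟩ := hQ τ y
  refine ⟨_, hPτ.seq (hQρ.seq (exec_assign b rfl)), ?_, fun i hi => ?_⟩
  · rw [Function.update_self]
    refine hρ.trans (congrArg f (List.Vector.ext fun i => ?_))
    rw [List.Vector.get_map, List.Vector.get_ofFn, List.Vector.get_ofFn, hτ]
  · rw [Function.update_of_ne hi.ne, hρτ i (by omega), hτσ i hi]

theorem exists_realizes_prec {args : List.Vector ℕ (n + 1)} {f : List.Vector ℕ n → ℕ}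
    {g : List.Vector ℕ (n + 2) → ℕ} (hargs : ∀ i, args.get i < b)
    (hf : ∃ P, Realizes P args.tail b f)
    (hg : ∃ P, Realizes P ((b + 1) ::ᵥ b ::ᵥ args.tail) (b + 2) g) :
    ∃ P, Realizes P args b fun v =>
      v.head.rec (f v.tail) fun k r => g (k ::ᵥ r ::ᵥ v.tail) := by
  obtain ⟨P, hP⟩ := hf
  obtain ⟨Q, hQ⟩ := hg
  have hhead : args.head < b := by simpa using hargs 0
  have htail : ∀ i, args.tail.get i < b := fun i => by simpa using hargs i.succ
  refine ⟨.seq P (.seq (.assign (b + 1) (.num 0)) (.whileDo (.lt (.loc (b + 1)) (.loc args.head))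
    (.seq Q (.seq (.assign b (.loc (b + 2)))
      (.assign (b + 1) (.add (.loc (b + 1)) (.num 1))))))), fun σ y => ?_⟩
  let r : ℕ → ℕ := fun k =>
    k.rec (f (args.tail.map σ)) fun k r => g (k ::ᵥ r ::ᵥ args.tail.map σ)
  let I : ℕ → (ℕ → ℕ) → Prop := fun k τ => τ (b + 1) = k ∧ τ b = r k ∧ ∀ i < b, τ i = σ i
  obtain ⟨τ, hPτ, hτ, hτσ⟩ := hP σ y
  have hstart : I 0 (Function.update τ (b + 1) 0) :=
    ⟨by simp, by simpa [r] using hτ, fun i hi => by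
      rw [Function.update_of_ne (by omega), hτσ i hi]⟩
  have hstep : ∀ k < σ args.head, ∀ τ, I k τ → ∃ ρ, Exec (.seq Q (.seq (.assign b (.loc (b + 2)))
      (.assign (b + 1) (.add (.loc (b + 1)) (.num 1))))) ⟨τ, y⟩ ⟨ρ, y⟩ ∧ I (k + 1) ρ := by
    rintro k - τ ⟨hk, hr, hτσ⟩
    obtain ⟨ρ, hQρ, hρ, hρτ⟩ := hQ τ y
    refine ⟨_, hQρ.seq ((exec_assign _ rfl).seq (exec_assign _ rfl)), ?_, ?_, fun i hi => ?_⟩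
    · simp [hρτ, hk]
    · simp [hρ, hk, hr, map_congr_of_lt htail hτσ, r]
    · rw [Function.update_of_ne (by omega), Function.update_of_ne hi.ne, hρτ i (by omega),
        hτσ i hi]
  obtain ⟨ρ, hwhile, hρ⟩ := exists_exec_for
    (fun k τ hτ => ⟨hτ.1, hτ.2.2 _ hhead⟩) hstep (Nat.zero_le _) hstart
  exact ⟨ρ, hPτ.seq ((exec_assign _ rfl).seq hwhile), by simpa [r] using hρ.2.1, hρ.2.2⟩

theorem exists_realizes {f : List.Vector ℕ n → ℕ} (hf : Nat.Primrec' f)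
    (hargs : ∀ i, args.get i < b) : ∃ P, Realizes P args b f := by
  induction hf generalizing b with
  | zero => exact ⟨_, realizes_assign (a := .num 0) fun _ _ => rfl⟩
  | succ =>
    exact ⟨_, realizes_assign (a := .add (.loc args.head) (.num 1)) fun σ y => by
      simp [AExp.eval]⟩
  | get i => exact ⟨_, realizes_assign (a := .loc (args.get i)) fun σ y => by simp [AExp.eval]⟩
  | comp g _ _ ihf ihg =>
    exact exists_realizes_comp hargs (fun _ _ h => ihf h) fun i c hc =>
      ihg i fun j => (hargs j).trans_le hc
  | prec _ _ ihf ihg =>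
    refine exists_realizes_prec hargs (ihf fun i => ?_) (ihg fun i => ?_)
    · simpa using hargs i.succ
    · refine Fin.cases (Nat.lt_succ_self _) (Fin.cases ?_ fun i => ?_) i
      · rw [List.Vector.get_cons_succ, List.Vector.get_cons_zero]
        omega
      · simpa using (hargs i.succ).trans (Nat.lt_add_of_pos_right Nat.two_pos)

end Realizes

/-! ### Universality -/

theorem Exec.exists_of_while_invariant {b : BExp} {P : Sentence} {I : State → Prop}
    (hI : ∀ {s s₁ t}, I s → b.eval s = some (true, s₁) → Exec P s₁ t → I t) {s t : State}
    (h : Exec (.whileDo b P) s t) (hs : I s) : ∃ t', I t' ∧ b.eval t' = some (false, t) := by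
  generalize hw : Sentence.whileDo b P = W at h
  induction h with
  | while_true hb hP _ _ ih =>
    cases hw
    exact ih (hI hs hb hP) rfl
  | while_false hb =>
    cases hw
    exact ⟨_, hs, hb⟩
  | _ => cases hw

/-- The sentence `L` sets `x[2] := f x[0] x[1]` without reading input or changing `x[0]`, `x[1]`;
the other locations are free workspace. -/
def Tabulates (L : Sentence) (f : ℕ → ℕ → ℕ) : Prop :=
  Realizes L (0 ::ᵥ 1 ::ᵥ List.Vector.nil) 2 fun v => f v.head v.tail.head

theorem exists_tabulates {f : ℕ → ℕ → ℕ} (hf : Primrec₂ f) : ∃ L, Tabulates L f :=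
  exists_realizes (Nat.Primrec'.prim_iff₂.2 hf)
    (Fin.forall_fin_two.2 ⟨Nat.zero_lt_two, Nat.one_lt_two⟩)

/-- One round of the search loop `scan`, with the index of the consumed part of the input in
`x[0]` and the stage of the search in `x[1]`: the subprogram `L` puts the lookahead at that stage
into `x[2]`, and then either the next input bit is appended to the consumed part (lookahead `1`)
or the search proceeds to the next stage. -/
def scanBody (L : Sentence) : Sentence :=
  .seq L (.ite (.eq (.loc 2) (.num 1))
    (.seq (.assign 0 (.add (.add (.loc 0) (.add (.loc 0) (.num 1))) .readbit))
      (.assign 1 (.num 0)))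
    (.assign 1 (.add (.loc 1) (.num 1))))

/-- The search loop of the universal simulation: search and read on, until the lookahead computed
by `L` is a value `v + 2`. -/
def scan (L : Sentence) : Sentence :=
  .whileDo (.lt (.loc 2) (.num 2)) (scanBody L)

section Scan

variable {L : Sentence} {f : ℕ → ℕ → ℕ} {σ : ℕ → ℕ} {y z : List Bool}

theorem Tabulates.exists_exec (hL : Tabulates L f) (σ : ℕ → ℕ) (z : List Bool) :
    ∃ τ, Exec L ⟨σ, z⟩ ⟨τ, z⟩ ∧ τ 0 = σ 0 ∧ τ 1 = σ 1 ∧ τ 2 = f (σ 0) (σ 1) := by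
  obtain ⟨τ, hexec, hτ, hτσ⟩ := hL σ z
  exact ⟨τ, hexec, hτσ 0 Nat.zero_lt_two, hτσ 1 Nat.one_lt_two, hτ⟩

theorem Tabulates.exists_exec_scanBody_read (hL : Tabulates L f) (hf : f (σ 0) (σ 1) = 1)
    (d : Bool) :
    ∃ τ, Exec (scanBody L) ⟨σ, d :: z⟩ ⟨τ, z⟩ ∧ τ 0 = 2 * σ 0 + 1 + d.toNat ∧ τ 1 = 0 ∧
      τ 2 = 1 := by
  obtain ⟨τ, hexec, h0, -, h2⟩ := hL.exists_exec σ (d :: z)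
  refine ⟨_, hexec.seq (.ite_true (s₁ := ⟨τ, d :: z⟩) (by simp [BExp.eval, AExp.eval, h2, hf])
    ((exec_assign 0 rfl).seq (exec_assign 1 rfl))), ?_, ?_, ?_⟩
  · simp [h0]
    ring
  all_goals simp [h2, hf]

theorem Tabulates.exists_exec_scanBody_next (hL : Tabulates L f) (hf : f (σ 0) (σ 1) ≠ 1) :
    ∃ τ, Exec (scanBody L) ⟨σ, z⟩ ⟨τ, z⟩ ∧ τ 0 = σ 0 ∧ τ 1 = σ 1 + 1 ∧
      τ 2 = f (σ 0) (σ 1) := by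
  obtain ⟨τ, hexec, h0, h1, h2⟩ := hL.exists_exec σ z
  refine ⟨_, hexec.seq (.ite_false (s₁ := ⟨τ, z⟩) (by simp [BExp.eval, AExp.eval, h2, hf])
    (exec_assign 1 rfl)), ?_, ?_, ?_⟩
  all_goals simp [h0, h1, h2]

theorem Tabulates.not_exec_scanBody_nil (hL : Tabulates L f) (hf : f (σ 0) (σ 1) = 1)
    (t : State) : ¬ Exec (scanBody L) ⟨σ, []⟩ t := by
  obtain ⟨τ, hexec, -, -, h2⟩ := hL.exists_exec σ []
  rintro (_ | _ | _ | _ | ⟨hexec', hite⟩)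
  obtain rfl := hexec.det hexec'
  cases hite with
  | ite_true hb hread =>
    obtain _ | _ | _ | _ | ⟨hassign, -⟩ := hread
    cases hassign with
    | assign ha =>
      simp only [BExp.eval, AExp.eval, Option.bind_eq_bind, Option.bind_some, Option.pure_def,
        Option.some.injEq, Prod.mk.injEq] at hb
      simp [AExp.eval, ← hb.2] at ha
  | ite_false hb => simp [BExp.eval, AExp.eval, h2, hf] at hb

theorem eval_scan_guard (s : State) :
    (BExp.lt (.loc 2) (.num 2)).eval s = some (decide (s.mem 2 < 2), s) :=
  rfl

theorem Tabulates.exists_of_exec_scan (hL : Tabulates L f) {τ : ℕ → ℕ}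
    (h : Exec (scan L) ⟨fun _ => 0, y⟩ ⟨τ, z⟩) :
    bstr (τ 0) ++ z = y ∧ ∃ k, f (τ 0) k = τ 2 ∧ 2 ≤ τ 2 := by
  let I : State → Prop := fun s =>
    bstr (s.mem 0) ++ s.input = y ∧ (2 ≤ s.mem 2 → ∃ k, f (s.mem 0) k = s.mem 2)
  have hstep : ∀ {s s₁ t}, I s → (BExp.lt (.loc 2) (.num 2)).eval s = some (true, s₁) →
      Exec (scanBody L) s₁ t → I t := by
    rintro ⟨σ, z⟩ s₁ t ⟨hy, -⟩ hb hbody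
    simp only [eval_scan_guard, Option.some.injEq, Prod.mk.injEq] at hb
    obtain ⟨-, rfl⟩ := hb
    by_cases hf : f (σ 0) (σ 1) = 1
    · rcases z with _ | ⟨d, z⟩
      · exact absurd hbody (hL.not_exec_scanBody_nil hf t)
      · obtain ⟨τ, hτ, h0, -, h2⟩ := hL.exists_exec_scanBody_read hf d (z := z)
        obtain rfl := hbody.det hτ
        exact ⟨by simpa [h0, bstr_append_bit] using hy, fun h => by simp [h2] at h⟩
    · obtain ⟨τ, hτ, h0, -, h2⟩ := hL.exists_exec_scanBody_next hf (z := z)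
      obtain rfl := hbody.det hτ
      exact ⟨by simpa [h0] using hy, fun _ => ⟨σ 1, by simp [h0, h2]⟩⟩
  obtain ⟨t, ⟨hy, ht⟩, hexit⟩ :=
    h.exists_of_while_invariant (I := I) hstep ⟨by simp [bstr_zero], by simp⟩
  simp only [eval_scan_guard, Option.some.injEq, Prod.mk.injEq, decide_eq_false_iff_not,
    not_lt] at hexit
  obtain ⟨h2, rfl⟩ := hexit
  obtain ⟨k, hk⟩ := ht h2
  exact ⟨hy, k, hk, h2⟩

theorem exec_scan_of_two_le (hσ : 2 ≤ σ 2) : Exec (scan L) ⟨σ, z⟩ ⟨σ, z⟩ :=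
  .while_false (by rw [eval_scan_guard, decide_eq_false hσ.not_gt])

theorem exec_scan_of_exec_scanBody {s t : State} (hσ : σ 2 < 2)
    (hbody : Exec (scanBody L) ⟨σ, z⟩ s) (hs : Exec (scan L) s t) : Exec (scan L) ⟨σ, z⟩ t :=
  .while_true (by rw [eval_scan_guard, decide_eq_true hσ]) hbody hs

theorem Tabulates.exists_exec_scan_imp (hL : Tabulates L f) (z : List Bool) {d : ℕ}
    (hf : ∀ k < d, f (σ 0) k = 0) (h1 : σ 1 = 0) (h2 : σ 2 < 2) :
    ∃ τ, τ 0 = σ 0 ∧ τ 1 = d ∧ τ 2 < 2 ∧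
      ∀ t, Exec (scan L) ⟨τ, z⟩ t → Exec (scan L) ⟨σ, z⟩ t := by
  induction d with
  | zero => exact ⟨σ, rfl, h1, h2, fun _ h => h⟩
  | succ d ih =>
    obtain ⟨τ, h0, h1, h2, himp⟩ := ih fun k hk => hf k (by omega)
    have hzero : f (τ 0) (τ 1) = 0 := by rw [h0, h1, hf d (Nat.lt_succ_self d)]
    obtain ⟨ρ, hρ, h0', h1', h2'⟩ := hL.exists_exec_scanBody_next (z := z) (by rw [hzero]; simp)
    exact ⟨ρ, h0'.trans h0, by rw [h1', h1], by rw [h2', hzero]; simp,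
      fun t ht => himp t (exec_scan_of_exec_scanBody h2 hρ ht)⟩

theorem Tabulates.exists_exec_scan (hL : Tabulates L f) {v : ℕ} (hv : 2 ≤ v)
    (hex : ∀ n z, bstr n ++ z = y → ∃ k, f n k ≠ 0)
    (hf : ∀ n z, bstr n ++ z = y → ∀ k, f n k ≠ 0 → f n k = if z = [] then v else 1)
    (hz : bstr (σ 0) ++ z = y) (h1 : σ 1 = 0) (h2 : σ 2 < 2) :
    ∃ τ, Exec (scan L) ⟨σ, z⟩ ⟨τ, []⟩ ∧ τ 2 = v := by
  classical
  induction z generalizing σ with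
  | nil =>
    have hk := hex _ _ hz
    obtain ⟨τ, h0, h1, h2, himp⟩ := hL.exists_exec_scan_imp []
      (fun k hlt => not_not.1 (Nat.find_min hk hlt)) h1 h2
    have hv' : f (τ 0) (τ 1) = v := by rw [h0, h1, hf _ _ hz _ (Nat.find_spec hk), if_pos rfl]
    obtain ⟨ρ, hρ, -, -, h2'⟩ := hL.exists_exec_scanBody_next (z := []) (σ := τ) (by omega)
    exact ⟨ρ, himp _ (exec_scan_of_exec_scanBody h2 hρ (exec_scan_of_two_le (by omega))),
      h2'.trans hv'⟩
  | cons d z ih =>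
    have hk := hex _ _ hz
    obtain ⟨τ, h0, h1, h2, himp⟩ := hL.exists_exec_scan_imp (d :: z)
      (fun k hlt => not_not.1 (Nat.find_min hk hlt)) h1 h2
    have hread : f (τ 0) (τ 1) = 1 := by
      rw [h0, h1, hf _ _ hz _ (Nat.find_spec hk), if_neg (List.cons_ne_nil d z)]
    obtain ⟨ρ, hρ, h0', h1', h2'⟩ := hL.exists_exec_scanBody_read hread d (z := z)
    obtain ⟨τ', hτ', hv'⟩ := ih (by simpa [h0', h0, bstr_append_bit] using hz) h1' (by omega)
    exact ⟨τ', himp _ (exec_scan_of_exec_scanBody h2 hρ hτ'), hv'⟩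

end Scan

/-- The information that stage `k` of the search through a table `T` of values of a machine yields
about the consumed input `B_n`: the stage codes a pair `(w, j)`, and `T` at stage `j` may show the
machine to halt on `B_n · w`. The result is `0` if it does not, `1` if `w` is nonempty (so that a
bit may safely be read), and `v + 2` if `w` is empty and the value is `B_v`. -/
def lookahead (T : ℕ → ℕ → Option (List Bool)) (n k : ℕ) : ℕ :=
  ((Encodable.decode k : Option (List Bool × ℕ)).bind fun p =>
    (T (bappend n p.1) p.2).map fun x => if p.1 = [] then bappend 0 x + 2 else 1).getD 0

section Lookahead

variable {T : ℕ → ℕ → Option (List Bool)}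

theorem primrec_lookahead (hT : Primrec₂ T) : Primrec₂ (lookahead T) := by
  have hvalue : Primrec₂ fun (w x : List Bool) => if w = [] then bappend 0 x + 2 else 1 :=
    Primrec.ite (Primrec.eq.comp Primrec.fst (Primrec.const []))
      (Primrec.nat_add.comp (primrec_bappend.comp (Primrec.const 0) Primrec.snd)
        (Primrec.const 2)) (Primrec.const 1)
  have hsearch : Primrec₂ fun (n : ℕ) (p : List Bool × ℕ) => T (bappend n p.1) p.2 :=
    hT.comp (primrec_bappend.comp Primrec.fst (Primrec.fst.comp Primrec.snd))
      (Primrec.snd.comp Primrec.snd)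
  exact Primrec.option_getD.comp (Primrec.option_bind (Primrec.decode.comp Primrec.snd)
    (Primrec.option_map (hsearch.comp (Primrec.fst.comp Primrec.fst) Primrec.snd)
      (hvalue.comp (Primrec.fst.comp (Primrec.snd.comp Primrec.fst)) Primrec.snd).to₂).to₂)
    (Primrec.const 0)

variable {G : List Bool →. List Bool}

/-- The stages `T n 0, T n 1, …` semi-decide the value of `G` at the `n`-th string; repeated
values are allowed. -/
def Enumerates (T : ℕ → ℕ → Option (List Bool)) (G : List Bool →. List Bool) : Prop :=
  ∀ n x, x ∈ G (bstr n) ↔ ∃ j, T n j = some x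

theorem exists_enumerates (hG : Partrec G) :
    ∃ T, Primrec₂ T ∧ Enumerates T G :=
  exists_primrec_enum (hG.comp computable_bstr)

theorem Enumerates.exists_lookahead_eq_iff (hT : Enumerates T G) {n v : ℕ} (hv : v ≠ 0) :
    (∃ k, lookahead T n k = v) ↔ ∃ w, ∃ x ∈ G (bstr n ++ w),
      v = if w = [] then bappend 0 x + 2 else 1 := by
  simp only [← bstr_bappend, hT _ _]
  constructor
  · rintro ⟨k, rfl⟩
    rcases hk : (Encodable.decode k : Option (List Bool × ℕ)) with _ | ⟨w, j⟩
    · simp [lookahead, hk] at hv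
    · rcases hTx : T (bappend n w) j with _ | x
      · simp [lookahead, hk, hTx] at hv
      · exact ⟨w, x, ⟨j, hTx⟩, by simp [lookahead, hk, hTx]⟩
  · rintro ⟨w, x, ⟨j, hTx⟩, rfl⟩
    refine ⟨Encodable.encode (w, j), ?_⟩
    simp only [lookahead, Encodable.encodek, Option.bind_some, hTx, Option.map_some,
      Option.getD_some]

theorem Enumerates.lookahead_eq (hT : Enumerates T G)
    (hfree : ∀ p ∈ G.Dom, ∀ q ∈ G.Dom, p <+: q → p = q) {n k : ℕ} {x z : List Bool}
    (hx : x ∈ G (bstr n ++ z)) (hk : lookahead T n k ≠ 0) :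
    lookahead T n k = if z = [] then bappend 0 x + 2 else 1 := by
  obtain ⟨w, x', hx', heq⟩ := (hT.exists_lookahead_eq_iff hk).1 ⟨k, rfl⟩
  have hxdom : bstr n ++ z ∈ G.Dom := Part.dom_iff_mem.2 ⟨x, hx⟩
  have hx'dom : bstr n ++ w ∈ G.Dom := Part.dom_iff_mem.2 ⟨x', hx'⟩
  rw [heq]
  by_cases hw : w = [] <;> by_cases hz : z = []
  · subst hw hz
    rw [Part.mem_unique hx hx']
  · subst hw
    have := hfree _ hx'dom _ hxdom (by simp)
    simp_all
  · subst hz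
    have := hfree _ hxdom _ hx'dom (by simp)
    simp_all
  · rw [if_neg hw, if_neg hz]

theorem Enumerates.mem_of_exec_scan (hT : Enumerates T G) {L : Sentence}
    (hL : Tabulates L (lookahead T)) {y : List Bool} {τ : ℕ → ℕ}
    (h : Exec (scan L) ⟨fun _ => 0, y⟩ ⟨τ, []⟩) : bstr (τ 2 - 2) ∈ G y := by
  obtain ⟨hy, k, hk, h2⟩ := hL.exists_of_exec_scan h
  obtain ⟨w, x, hx, hw⟩ := (hT.exists_lookahead_eq_iff (by omega)).1 ⟨k, hk⟩
  obtain rfl : w = [] := by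
    by_contra hne
    rw [if_neg hne] at hw
    omega
  rw [if_pos rfl] at hw
  simpa [hw, bstr_bappend_zero, ← hy] using hx

theorem Enumerates.exists_exec_scan (hT : Enumerates T G) {L : Sentence}
    (hL : Tabulates L (lookahead T)) (hfree : ∀ p ∈ G.Dom, ∀ q ∈ G.Dom, p <+: q → p = q)
    {x y : List Bool} (hx : x ∈ G y) :
    ∃ τ, Exec (scan L) ⟨fun _ => 0, y⟩ ⟨τ, []⟩ ∧ τ 2 = bappend 0 x + 2 := by
  have hex : ∀ n z, bstr n ++ z = y → ∃ k, lookahead T n k ≠ 0 := by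
    rintro n z rfl
    have hv : (if z = [] then bappend 0 x + 2 else 1) ≠ 0 := by split_ifs <;> simp
    obtain ⟨k, hk⟩ := (hT.exists_lookahead_eq_iff hv).2 ⟨z, x, hx, rfl⟩
    exact ⟨k, hk ▸ hv⟩
  exact hL.exists_exec_scan (σ := fun _ => 0) (z := y) (Nat.le_add_left 2 _) hex
    (fun n z hy k => hT.lookahead_eq hfree (hy ▸ hx)) (by simp [bstr_zero]) rfl Nat.zero_lt_two

theorem exists_run_eq (hG : IsPrefixMachine G) : ∃ n, ∀ y, (sentence n).run y = G y := by
  obtain ⟨T, hT, hTG⟩ := exists_enumerates hG.partrec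
  obtain ⟨L, hL⟩ := exists_tabulates (primrec_lookahead hT)
  obtain ⟨Q, hQ⟩ := exists_outputs_iff (.seq (scan L) (.assign 0 (.sub (.loc 2) (.num 2))))
  refine ⟨sentence.symm Q, fun y => Part.ext fun x => ?_⟩
  rw [Equiv.apply_symm_apply, Sentence.mem_run, hQ]
  constructor
  · rintro ⟨τ, hexec, rfl⟩
    obtain _ | _ | _ | _ | @⟨_, _, _, ⟨ρ, z⟩, _, hscan, hassign⟩ := hexec
    have hend := hassign.det (exec_assign 0 rfl)
    simp only [State.mk.injEq] at hend
    obtain ⟨rfl, rfl⟩ := hend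
    exact hTG.mem_of_exec_scan hL hscan
  · intro hx
    obtain ⟨τ, hτ, hτx⟩ := hTG.exists_exec_scan hL hG.prefixFree hx
    exact ⟨_, hτ.seq (exec_assign 0 rfl), by simp [hτx, bstr_bappend_zero]⟩

end Lookahead

/-! ### Computability of the syntax -/

theorem primrec_choose (k : ℕ) : Primrec fun n : ℕ => n.choose k := by
  have hdesc : Primrec fun n : ℕ => n.descFactorial k := by
    induction k with
    | zero => exact Primrec.const 1
    | succ k ih => exact Primrec.nat_mul.comp (Primrec.nat_sub.comp .id (.const k)) ih
  exact (Primrec.nat_div.comp hdesc (.const k.factorial)).of_eq fun n =>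
    (Nat.choose_eq_descFactorial_div_factorial n k).symm

theorem primrec_pair : Primrec₂ pair := by
  have hsum : Primrec₂ fun x y : ℕ => x + y + 1 := Primrec.succ.comp₂ Primrec.nat_add
  exact Primrec.nat_add.comp₂ .left ((primrec_choose 2).comp₂ hsum)

theorem primrec_triple : Primrec fun t : ℕ × ℕ × ℕ => triple t.1 t.2.1 t.2.2 := by
  have hx : Primrec fun t : ℕ × ℕ × ℕ => t.1 := .fst
  have hy : Primrec fun t : ℕ × ℕ × ℕ => t.2.1 := Primrec.fst.comp .snd
  have hz : Primrec fun t : ℕ × ℕ × ℕ => t.2.2 := Primrec.snd.comp .snd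
  have hsum : Primrec fun t : ℕ × ℕ × ℕ => t.1 + t.2.1 + t.2.2 + 2 :=
    Primrec.nat_add.comp (Primrec.nat_add.comp (Primrec.nat_add.comp hx hy) hz) (.const 2)
  exact Primrec.nat_add.comp (primrec_pair.comp hx hy) ((primrec_choose 3).comp hsum)

/-- The enumeration of the arithmetic expressions by their positions. -/
noncomputable def AExp.rankEquiv : AExp ≃ ℕ :=
  Equiv.ofBijective rank ⟨rank_injective, rank_surjective⟩

noncomputable instance : Primcodable AExp :=
  .ofEquiv ℕ AExp.rankEquiv

noncomputable instance : Primcodable BExp :=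
  .ofEquiv ℕ (Equiv.ofBijective BExp.rank ⟨BExp.rank_injective, BExp.rank_surjective⟩)

noncomputable instance : Primcodable Sentence :=
  .ofEquiv ℕ sentence.symm

section Expressions

variable {α β γ δ : Type*} [Primcodable α] [Primcodable β] [Primcodable γ] [Primcodable δ]

theorem computable_of_encode_eq {x : α → β} {f : α → δ} (k c : ℕ) (hx : Computable x)
    (hf : ∀ a, Encodable.encode (f a) = k * Encodable.encode (x a) + c) : Computable f := by
  have hlin : Computable fun n => k * n + c :=
    (Primrec.nat_add.comp (Primrec.nat_mul.comp (.const k) .id) (.const c)).to_comp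
  exact Computable.encode_iff.1 <|
    (hlin.comp (Computable.encode.comp hx)).of_eq fun a => (hf a).symm

theorem computable_of_encode_eq_pair {x : α → β} {y : α → γ} {f : α → δ} (k c : ℕ)
    (hx : Computable x) (hy : Computable y)
    (hf : ∀ a, Encodable.encode (f a) =
      k * pair (Encodable.encode (x a)) (Encodable.encode (y a)) + c) : Computable f :=
  computable_of_encode_eq k c
    (primrec_pair.to_comp.comp (Computable.encode.comp hx) (Computable.encode.comp hy)) hf

/-- An arithmetic expression as its top production rule together with its arguments. -/
def AExp.view : Unit ⊕ ℕ ⊕ ℕ ⊕ (AExp × AExp) ⊕ (AExp × AExp) ⊕ (AExp × AExp) ≃ AExp where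
  toFun := Sum.elim (fun _ => readbit) <| Sum.elim num <| Sum.elim loc <|
    Sum.elim (fun p => add p.1 p.2) <| Sum.elim (fun p => sub p.1 p.2) fun p => mul p.1 p.2
  invFun
    | readbit => .inl ()
    | num n => .inr (.inl n)
    | loc n => .inr (.inr (.inl n))
    | add a₁ a₂ => .inr (.inr (.inr (.inl (a₁, a₂))))
    | sub a₁ a₂ => .inr (.inr (.inr (.inr (.inl (a₁, a₂)))))
    | mul a₁ a₂ => .inr (.inr (.inr (.inr (.inr (a₁, a₂)))))
  left_inv := by rintro (_ | _ | _ | _ | _ | _) <;> rfl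
  right_inv := by rintro (_ | _ | _ | _ | _ | _) <;> rfl

/-- A boolean expression as its top production rule together with its arguments. -/
def BExp.view : Unit ⊕ Unit ⊕ (AExp × AExp) ⊕ (AExp × AExp) ⊕ (BExp × BExp) ⊕ (BExp × BExp) ⊕
    BExp ≃ BExp where
  toFun := Sum.elim (fun _ => tt) <| Sum.elim (fun _ => ff) <|
    Sum.elim (fun p => eq p.1 p.2) <| Sum.elim (fun p => lt p.1 p.2) <|
    Sum.elim (fun p => and p.1 p.2) <| Sum.elim (fun p => or p.1 p.2) not
  invFun
    | tt => .inl ()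
    | ff => .inr (.inl ())
    | eq a₁ a₂ => .inr (.inr (.inl (a₁, a₂)))
    | lt a₁ a₂ => .inr (.inr (.inr (.inl (a₁, a₂))))
    | and b₁ b₂ => .inr (.inr (.inr (.inr (.inl (b₁, b₂)))))
    | or b₁ b₂ => .inr (.inr (.inr (.inr (.inr (.inl (b₁, b₂))))))
    | not b => .inr (.inr (.inr (.inr (.inr (.inr b)))))
  left_inv := by rintro (_ | _ | _ | _ | _ | _ | _) <;> rfl
  right_inv := by rintro (_ | _ | _ | _ | _ | _ | _) <;> rfl

/-- A sentence as its top production rule together with its arguments. -/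
def Sentence.view : Unit ⊕ (ℕ × AExp) ⊕ (BExp × Sentence) ⊕ (Sentence × Sentence) ⊕
    (BExp × Sentence × Sentence) ≃ Sentence where
  toFun := Sum.elim (fun _ => skip) <| Sum.elim (fun p => assign p.1 p.2) <|
    Sum.elim (fun p => .whileDo p.1 p.2) <| Sum.elim (fun p => seq p.1 p.2)
    fun p => ite p.1 p.2.1 p.2.2
  invFun
    | skip => .inl ()
    | assign n a => .inr (.inl (n, a))
    | .whileDo b P => .inr (.inr (.inl (b, P)))
    | seq P Q => .inr (.inr (.inr (.inl (P, Q))))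
    | ite b P Q => .inr (.inr (.inr (.inr (b, P, Q))))
  left_inv := by rintro (_ | _ | _ | _ | _) <;> rfl
  right_inv := by rintro (_ | _ | _ | _ | _) <;> rfl

theorem computable_sum_elim {f : α → δ} {g : β → δ} (hf : Computable f) (hg : Computable g) :
    Computable (Sum.elim f g) :=
  (computable₂_sum_elim (hf.comp .snd).to₂ (hg.comp .snd).to₂).comp (.const ()) .id

theorem AExp.computable_num : Computable num :=
  computable_of_encode_eq 5 1 .id fun _ => rfl

theorem AExp.computable_loc : Computable loc :=
  computable_of_encode_eq 5 2 .id fun _ => rfl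

theorem AExp.computable_add : Computable fun p : AExp × AExp => add p.1 p.2 :=
  computable_of_encode_eq_pair 5 3 .fst .snd fun _ => rfl

theorem AExp.computable_sub : Computable fun p : AExp × AExp => sub p.1 p.2 :=
  computable_of_encode_eq_pair 5 4 .fst .snd fun _ => rfl

theorem AExp.computable_mul : Computable fun p : AExp × AExp => mul p.1 p.2 :=
  computable_of_encode_eq_pair 5 5 .fst .snd fun _ => rfl

theorem AExp.computable_view : Computable AExp.view :=
  computable_sum_elim (.const readbit) <|
  computable_sum_elim computable_num <|
  computable_sum_elim computable_loc <|
  computable_sum_elim computable_add <|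
  computable_sum_elim computable_sub computable_mul

theorem BExp.computable_view : Computable BExp.view :=
  computable_sum_elim (.const tt) <|
  computable_sum_elim (.const ff) <|
  computable_sum_elim (computable_of_encode_eq_pair 5 2 .fst .snd fun _ => rfl) <|
  computable_sum_elim (computable_of_encode_eq_pair 5 3 .fst .snd fun _ => rfl) <|
  computable_sum_elim (computable_of_encode_eq_pair 5 4 .fst .snd fun _ => rfl) <|
  computable_sum_elim (computable_of_encode_eq_pair 5 5 .fst .snd fun _ => rfl) <|
  computable_of_encode_eq 5 6 .id fun _ => rfl

theorem Sentence.computable_whileDo :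
    Computable fun p : BExp × Sentence => Sentence.whileDo p.1 p.2 :=
  computable_of_encode_eq_pair 4 2 .fst .snd fun _ => rfl

theorem Sentence.computable_seq : Computable fun p : Sentence × Sentence => seq p.1 p.2 :=
  computable_of_encode_eq_pair 4 3 .fst .snd fun _ => rfl

theorem Sentence.computable_ite :
    Computable fun p : BExp × Sentence × Sentence => ite p.1 p.2.1 p.2.2 :=
  computable_of_encode_eq 4 4 (primrec_triple.to_comp.comp <|
    (Computable.encode.comp .fst).pair <|
      (Computable.encode.comp (Computable.fst.comp .snd)).pair <|
        Computable.encode.comp (Computable.snd.comp .snd)) fun _ => rfl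

theorem Sentence.computable_view : Computable Sentence.view :=
  computable_sum_elim (.const skip) <|
  computable_sum_elim (computable_of_encode_eq_pair 4 1 .fst .snd fun _ => rfl) <|
  computable_sum_elim computable_whileDo <|
  computable_sum_elim computable_seq computable_ite

theorem computable₂_of_view {e : β ≃ γ} (he : Computable e) {F : α → γ → δ}
    (hF : Computable₂ fun a b => F a (e b)) : Computable₂ F :=
  (hF.comp .fst ((computable_symm e he).comp .snd)).of_eq fun p => by
    rw [e.apply_symm_apply]

theorem AExp.computable₂_cases {F : α → AExp → δ} (hreadbit : Computable fun a => F a readbit)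
    (hnum : Computable₂ fun a n => F a (num n)) (hloc : Computable₂ fun a n => F a (loc n))
    (hadd : Computable₂ fun a (p : AExp × AExp) => F a (add p.1 p.2))
    (hsub : Computable₂ fun a (p : AExp × AExp) => F a (sub p.1 p.2))
    (hmul : Computable₂ fun a (p : AExp × AExp) => F a (mul p.1 p.2)) : Computable₂ F := by
  refine computable₂_of_view computable_view <|
    (computable₂_sum_elim (hreadbit.comp .fst).to₂ <| computable₂_sum_elim hnum <|
      computable₂_sum_elim hloc <| computable₂_sum_elim hadd <|
      computable₂_sum_elim hsub hmul).of_eq ?_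
  rintro ⟨a, _ | _ | _ | _ | _ | _⟩ <;> rfl

theorem BExp.computable₂_cases {F : α → BExp → δ} (htt : Computable fun a => F a tt)
    (hff : Computable fun a => F a ff)
    (heq : Computable₂ fun a (p : AExp × AExp) => F a (eq p.1 p.2))
    (hlt : Computable₂ fun a (p : AExp × AExp) => F a (lt p.1 p.2))
    (hand : Computable₂ fun a (p : BExp × BExp) => F a (and p.1 p.2))
    (hor : Computable₂ fun a (p : BExp × BExp) => F a (or p.1 p.2))
    (hnot : Computable₂ fun a b => F a (not b)) : Computable₂ F := by
  refine computable₂_of_view computable_view <|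
    (computable₂_sum_elim (htt.comp .fst).to₂ <| computable₂_sum_elim (hff.comp .fst).to₂ <|
      computable₂_sum_elim heq <| computable₂_sum_elim hlt <| computable₂_sum_elim hand <|
      computable₂_sum_elim hor hnot).of_eq ?_
  rintro ⟨a, _ | _ | _ | _ | _ | _ | _⟩ <;> rfl

theorem Sentence.computable₂_cases {F : α → Sentence → δ}
    (hskip : Computable fun a => F a skip)
    (hassign : Computable₂ fun a (p : ℕ × AExp) => F a (assign p.1 p.2))
    (hwhile : Computable₂ fun a (p : BExp × Sentence) => F a (.whileDo p.1 p.2))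
    (hseq : Computable₂ fun a (p : Sentence × Sentence) => F a (seq p.1 p.2))
    (hite : Computable₂ fun a (p : BExp × Sentence × Sentence) => F a (ite p.1 p.2.1 p.2.2)) :
    Computable₂ F := by
  refine computable₂_of_view computable_view <|
    (computable₂_sum_elim (hskip.comp .fst).to₂ <| computable₂_sum_elim hassign <|
      computable₂_sum_elim hwhile <| computable₂_sum_elim hseq hite).of_eq ?_
  rintro ⟨a, _ | _ | _ | _ | _⟩ <;> rfl

theorem computable_sentence : Computable sentence :=
  computable_symm sentence.symm Computable.encode

end Expressions

/-! ### The interpreter -/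

/-- The memory in which the first locations hold the entries of `l`, and the others `0`. -/
def memory (l : List ℕ) (i : ℕ) : ℕ := l.getD i 0

/-- The list of memory contents after storing `v` at location `n`. -/
def store (l : List ℕ) (n v : ℕ) : List ℕ :=
  (List.range (max l.length (n + 1))).map fun i => if i = n then v else l.getD i 0

theorem memory_store (l : List ℕ) (n v : ℕ) :
    memory (store l n v) = Function.update (memory l) n v := by
  ext i
  rw [Function.update_apply, memory, memory, store]
  by_cases hi : i < max l.length (n + 1)
  · simp [hi]
  · rw [List.getD_eq_default _ _ (by simpa using hi), List.getD_eq_default _ _ (by omega),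
      if_neg (by omega)]

theorem memOutput_memory (l : List ℕ) : MemOutput (memory l) (l.flatMap bstr) := by
  have hl : (List.range l.length).map (memory l) = l :=
    List.ext_getElem (by simp) fun i _ hi => by simp [memory, hi]
  exact ⟨l.length, fun i hi => List.getD_eq_default _ _ hi, by
    conv_lhs => rw [← hl, List.flatMap_map]⟩

/-- The value of `a` on memory `l` and input `y`, together with the remaining input. -/
def AExp.value (a : AExp) (l : List ℕ) (y : List Bool) : Option (ℕ × List Bool) :=
  (a.eval ⟨memory l, y⟩).map fun p => (p.1, p.2.input)

theorem AExp.value_eq_some_iff {a : AExp} {l : List ℕ} {y z : List Bool} {v : ℕ} :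
    a.value l y = some (v, z) ↔ a.eval ⟨memory l, y⟩ = some (v, ⟨memory l, z⟩) := by
  simp only [value, Option.map_eq_some_iff, Prod.mk.injEq]
  constructor
  · rintro ⟨⟨v, t⟩, h, rfl, rfl⟩
    rw [h, ← show t.mem = memory l from eval_mem h]
  · exact fun h => ⟨_, h, rfl, rfl⟩

/-- The values of `a₁` and then `a₂` on memory `l` and input `y`, and the remaining input. -/
def AExp.value₂ (a₁ a₂ : AExp) (l : List ℕ) (y : List Bool) : Option (ℕ × ℕ × List Bool) :=
  (a₁.value l y).bind fun p => (a₂.value l p.2).map fun q => (p.1, q)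

/-- A configuration of the interpreter: the sentences that remain to be executed, in this order,
the memory contents, and the unread input. -/
abbrev Config : Type := List Sentence × List ℕ × List Bool

/-- One step in the execution of `if b then P else Q`, which yields the sentence to execute next
and the remaining input. Compound conditions are split into nested conditionals, so that boolean
values are never stored. -/
def BExp.branch (P Q : Sentence) (l : List ℕ) (y : List Bool) :
    BExp → Option (Sentence × List Bool)
  | tt => some (P, y)
  | ff => some (Q, y)
  | eq a₁ a₂ => (AExp.value₂ a₁ a₂ l y).map fun p => (if p.1 = p.2.1 then P else Q, p.2.2)
  | lt a₁ a₂ => (AExp.value₂ a₁ a₂ l y).map fun p => (if p.1 < p.2.1 then P else Q, p.2.2)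
  | and b₁ b₂ => some (.ite b₁ (.ite b₂ P Q) Q, y)
  | or b₁ b₂ => some (.ite b₁ P (.ite b₂ P Q), y)
  | not b => some (.ite b Q P, y)

/-- One step in the execution of a sentence followed by the sentences `K`. -/
def Sentence.next (K : List Sentence) (l : List ℕ) (y : List Bool) : Sentence → Option Config
  | skip => some (K, l, y)
  | assign n a => (a.value l y).map fun p => (K, store l n p.1, p.2)
  | .whileDo b P => some (.ite b (.seq P (.whileDo b P)) .skip :: K, l, y)
  | seq P Q => some (P :: Q :: K, l, y)
  | ite b P Q => (b.branch P Q l y).map fun p => (p.1 :: K, l, p.2)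

/-- One step of the interpreter; the result is `none` if the execution has ended or is stuck at a
`readbit`. -/
def step : Config → Option Config
  | ([], _, _) => none
  | (P :: K, l, y) => P.next K l y

theorem exec_ite_iff {b : BExp} {P Q : Sentence} {s t : State} :
    Exec (.ite b P Q) s t ↔ ∃ c u, b.eval s = some (c, u) ∧ Exec (if c then P else Q) u t := by
  constructor
  · rintro (_ | _ | _ | _ | _ | ⟨hb, hP⟩ | ⟨hb, hQ⟩)
    · exact ⟨true, _, hb, hP⟩
    · exact ⟨false, _, hb, hQ⟩
  · rintro ⟨_ | _, u, hb, h⟩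
    · exact .ite_false hb h
    · exact .ite_true hb h

theorem exec_ite_of_branch {b : BExp} {P Q R : Sentence} {l : List ℕ} {y z : List Bool}
    {t : State} (hb : b.branch P Q l y = some (R, z)) (hR : Exec R ⟨memory l, z⟩ t) :
    Exec (.ite b P Q) ⟨memory l, y⟩ t := by
  rw [exec_ite_iff]
  cases b with
  | tt | ff =>
    simp only [BExp.branch, Option.some.injEq, Prod.mk.injEq] at hb
    obtain ⟨rfl, rfl⟩ := hb
    exact ⟨_, _, rfl, hR⟩
  | eq a₁ a₂ | lt a₁ a₂ =>
    simp only [BExp.branch, AExp.value₂, Option.bind_eq_some_iff, Option.map_eq_some_iff,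
      Prod.exists, AExp.value_eq_some_iff, Prod.mk.injEq] at hb
    obtain ⟨v₁, v₂, y₂, ⟨v₁, y₁, h₁, v₂, y₂, h₂, rfl, rfl, rfl⟩, rfl, rfl⟩ := hb
    exact ⟨_, _, by simp only [BExp.eval, h₁, h₂, Option.bind_eq_bind, Option.bind_some]; rfl,
      by simpa using hR⟩
  | and b₁ b₂ | or b₁ b₂ | not b =>
    simp only [BExp.branch, Option.some.injEq, Prod.mk.injEq] at hb
    obtain ⟨rfl, rfl⟩ := hb
    obtain ⟨_ | _, u, hc, h⟩ := exec_ite_iff.1 hR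
    all_goals
      simp only [BExp.eval, hc, Option.bind_eq_bind, Option.bind_some, Bool.false_eq_true,
        if_false, if_true] at h ⊢
      first
        | exact exec_ite_iff.1 h
        | exact ⟨_, _, rfl, by simpa using h⟩

/-- Execution of a list of sentences one after the other. -/
def ExecAll : List Sentence → State → State → Prop
  | [], s, t => s = t
  | P :: K, s, t => ∃ u, Exec P s u ∧ ExecAll K u t

theorem execAll_of_step {P : Sentence} {K K' : List Sentence} {l l' : List ℕ}
    {y y' : List Bool} {t : State} (hstep : P.next K l y = some (K', l', y'))
    (ht : ExecAll K' ⟨memory l', y'⟩ t) : ExecAll (P :: K) ⟨memory l, y⟩ t := by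
  cases P with
  | skip =>
    cases hstep
    exact ⟨_, .skip _, ht⟩
  | assign n a =>
    simp only [Sentence.next, Option.map_eq_some_iff, Prod.exists, AExp.value_eq_some_iff] at hstep
    obtain ⟨v, z, ha, heq⟩ := hstep
    cases heq
    rw [memory_store] at ht
    exact ⟨_, exec_assign n ha, ht⟩
  | whileDo b P =>
    cases hstep
    obtain ⟨u, hu, ht⟩ := ht
    obtain ⟨_ | _, v, hb, hv⟩ := exec_ite_iff.1 hu
    · obtain _ | _ := hv
      exact ⟨_, .while_false hb, ht⟩
    · obtain _ | _ | _ | _ | ⟨hP, hw⟩ := hv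
      exact ⟨_, .while_true hb hP hw, ht⟩
  | seq P Q =>
    cases hstep
    obtain ⟨u, hu, v, hv, ht⟩ := ht
    exact ⟨_, hu.seq hv, ht⟩
  | ite b P Q =>
    simp only [Sentence.next, Option.map_eq_some_iff, Prod.exists] at hstep
    obtain ⟨R, z, hb, heq⟩ := hstep
    cases heq
    obtain ⟨u, hu, ht⟩ := ht
    exact ⟨u, exec_ite_of_branch hb hu, ht⟩

theorem execAll_of_reaches {c : Config} {l : List ℕ} {y : List Bool}
    (h : StateTransition.Reaches step c ([], l, y)) :
    ExecAll c.1 ⟨memory c.2.1, c.2.2⟩ ⟨memory l, y⟩ := by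
  induction h using Relation.ReflTransGen.head_induction_on with
  | refl => exact rfl
  | @head c c' hstep _ ih =>
    obtain ⟨_ | ⟨P, K⟩, l, y⟩ := c
    · cases hstep
    · exact execAll_of_step hstep ih

theorem reaches_of_eval {b : BExp} {P Q : Sentence} {l : List ℕ} {c : Bool} {s t : State}
    (hs : s.mem = memory l) (hb : b.eval s = some (c, t)) (K : List Sentence) :
    StateTransition.Reaches step (.ite b P Q :: K, l, s.input)
      ((if c then P else Q) :: K, l, t.input) := by
  induction b generalizing P Q s c t with
  | tt | ff =>
    cases hb
    exact .single rfl
  | eq a₁ a₂ | lt a₁ a₂ =>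
    simp only [BExp.eval, Option.bind_eq_bind, Option.bind_eq_some_iff, Prod.exists,
      Option.pure_def, Option.some.injEq, Prod.mk.injEq] at hb
    obtain ⟨v₁, s₁, h₁, v₂, s₂, h₂, rfl, rfl⟩ := hb
    obtain ⟨m, y⟩ := s
    obtain rfl : m = memory l := hs
    obtain ⟨m₁, y₁⟩ := s₁
    obtain rfl : m₁ = memory l := AExp.eval_mem h₁
    exact .single (by simp [step, Sentence.next, BExp.branch, AExp.value₂, AExp.value, h₁, h₂])
  | and b₁ b₂ ih₁ ih₂ | or b₁ b₂ ih₁ ih₂ =>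
    simp only [BExp.eval, Option.bind_eq_bind, Option.bind_eq_some_iff, Prod.exists] at hb
    obtain ⟨c₁, s₁, h₁, h₂⟩ := hb
    refine .head rfl ((ih₁ hs h₁).trans ?_)
    cases c₁
    all_goals
      simp only [Bool.false_eq_true, if_false, if_true] at h₂ ⊢
      first
        | exact ih₂ ((BExp.eval_mem h₁).trans hs) h₂
        | cases h₂; exact .refl
  | not b ih =>
    simp only [BExp.eval, Option.bind_eq_bind, Option.bind_eq_some_iff, Prod.exists,
      Option.pure_def, Option.some.injEq, Prod.mk.injEq] at hb
    obtain ⟨c₁, s₁, h₁, rfl, rfl⟩ := hb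
    refine .head rfl ?_
    cases c₁ <;> exact ih (P := Q) (Q := P) hs h₁

theorem Exec.exists_reaches {P : Sentence} {s t : State} (h : Exec P s t) {l : List ℕ}
    (hs : s.mem = memory l) : ∃ l', t.mem = memory l' ∧
      ∀ K, StateTransition.Reaches step (P :: K, l, s.input) (K, l', t.input) := by
  induction h generalizing l with
  | skip => exact ⟨l, hs, fun K => .single rfl⟩
  | @assign n a s s₁ v ha =>
    refine ⟨store l n v, by rw [memory_store, AExp.eval_mem ha, hs], fun K => .single ?_⟩
    simp [step, Sentence.next, AExp.value, ← hs, ha]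
  | while_true hb _ _ ih₁ ih₂ =>
    obtain ⟨l₁, h₁, hP⟩ := ih₁ ((BExp.eval_mem hb).trans hs)
    obtain ⟨l₂, h₂, hw⟩ := ih₂ h₁
    exact ⟨l₂, h₂, fun K => .head rfl <| (reaches_of_eval hs hb _).trans <|
      .head rfl <| (hP _).trans (hw K)⟩
  | while_false hb =>
    exact ⟨l, (BExp.eval_mem hb).trans hs, fun K => .head rfl <|
      (reaches_of_eval hs hb _).trans (.single rfl)⟩
  | seq _ _ ih₁ ih₂ =>
    obtain ⟨l₁, h₁, hP⟩ := ih₁ hs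
    obtain ⟨l₂, h₂, hQ⟩ := ih₂ h₁
    exact ⟨l₂, h₂, fun K => .head rfl <| (hP _).trans (hQ K)⟩
  | ite_true hb _ ih | ite_false hb _ ih =>
    obtain ⟨l₁, h₁, hP⟩ := ih ((BExp.eval_mem hb).trans hs)
    exact ⟨l₁, h₁, fun K => (reaches_of_eval hs hb _).trans (hP K)⟩

theorem Sentence.outputs_iff_reaches {P : Sentence} {y x : List Bool} :
    P.Outputs y x ↔
      ∃ l, StateTransition.Reaches step ([P], [], y) ([], l, []) ∧ x = l.flatMap bstr := by
  constructor
  · rintro ⟨σ, hexec, hx⟩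
    obtain ⟨l, hl : σ = memory l, hreach⟩ := hexec.exists_reaches (l := []) rfl
    exact ⟨l, hreach [], hx.unique (hl ▸ memOutput_memory l)⟩
  · rintro ⟨l, hreach, rfl⟩
    obtain ⟨_, hexec, rfl⟩ := execAll_of_reaches hreach
    exact ⟨_, hexec, memOutput_memory l⟩

theorem Sentence.outputs_iff_mem_eval {P : Sentence} {y x : List Bool} :
    P.Outputs y x ↔
      ∃ l, ([], l, []) ∈ StateTransition.eval step ([P], [], y) ∧ x = l.flatMap bstr := by
  simp only [outputs_iff_reaches, StateTransition.mem_eval, step, and_true]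

/-- The subexpressions of an arithmetic expression in the order in which they are evaluated. -/
def AExp.postorder : AExp → List AExp
  | readbit => [readbit]
  | num n => [num n]
  | loc n => [loc n]
  | add a₁ a₂ => a₁.postorder ++ a₂.postorder ++ [add a₁ a₂]
  | sub a₁ a₂ => a₁.postorder ++ a₂.postorder ++ [sub a₁ a₂]
  | mul a₁ a₂ => a₁.postorder ++ a₂.postorder ++ [mul a₁ a₂]

/-- The effect of the top production rule of an arithmetic expression on a stack of values, with
memory `l`, and on the input. -/
def AExp.push (l : List ℕ) (s : List ℕ × List Bool) : AExp → Option (List ℕ × List Bool)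
  | readbit => s.2.head?.map fun d => (d.toNat :: s.1, s.2.tail)
  | num n => some (n :: s.1, s.2)
  | loc n => some (memory l n :: s.1, s.2)
  | add _ _ => some ((s.1.tail.headI + s.1.headI) :: s.1.tail.tail, s.2)
  | sub _ _ => some ((s.1.tail.headI - s.1.headI) :: s.1.tail.tail, s.2)
  | mul _ _ => some ((s.1.tail.headI * s.1.headI) :: s.1.tail.tail, s.2)

theorem AExp.foldl_push_postorder (a : AExp) (l : List ℕ) (o : Option (List ℕ × List Bool)) :
    a.postorder.foldl (fun o b => o.bind fun s => b.push l s) o =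
      o.bind fun s => (a.value l s.2).map fun p => (p.1 :: s.1, p.2) := by
  induction a generalizing o with
  | readbit =>
    rcases o with _ | ⟨vs, _ | ⟨d, y⟩⟩ <;> rfl
  | num n | loc n =>
    rcases o with _ | s <;> rfl
  | add a₁ a₂ ih₁ ih₂ | sub a₁ a₂ ih₁ ih₂ | mul a₁ a₂ ih₁ ih₂ =>
    simp only [postorder, List.foldl_append, ih₁, ih₂, List.foldl_cons, List.foldl_nil]
    rcases o with _ | ⟨vs, y⟩
    · rfl
    simp only [Option.bind_some, value, eval]
    rcases h₁ : a₁.eval ⟨memory l, y⟩ with _ | ⟨v₁, m₁, y₁⟩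
    · rfl
    obtain rfl : m₁ = memory l := eval_mem h₁
    simp only [Option.map_some, Option.bind_some, Option.bind_eq_bind]
    rcases a₂.eval ⟨memory l, y₁⟩ with _ | ⟨v₂, s₂⟩ <;> rfl

/-- The subexpressions of an arithmetic expression in the order of evaluation, where those of its
arguments are looked up in a table `L` indexed by positions. -/
def AExp.postorderFrom (L : List (List AExp)) : AExp → List AExp
  | readbit => [readbit]
  | num n => [num n]
  | loc n => [loc n]
  | add a₁ a₂ => L.getD a₁.rank [] ++ L.getD a₂.rank [] ++ [add a₁ a₂]
  | sub a₁ a₂ => L.getD a₁.rank [] ++ L.getD a₂.rank [] ++ [sub a₁ a₂]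
  | mul a₁ a₂ => L.getD a₁.rank [] ++ L.getD a₂.rank [] ++ [mul a₁ a₂]

theorem AExp.postorderFrom_table (a : AExp) :
    a.postorderFrom ((List.range a.rank).map fun n => (rankEquiv.symm n).postorder) =
      a.postorder := by
  have hget (k : ℕ) (b : AExp) (hb : b.rank < k) :
      ((List.range k).map fun n => (rankEquiv.symm n).postorder).getD b.rank [] =
        b.postorder := by
    have hrank : rankEquiv.symm b.rank = b := rankEquiv.symm_apply_apply b
    rw [List.getD_eq_getElem _ _ (by simpa using hb), List.getElem_map, List.getElem_range, hrank]
  cases a with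
  | readbit | num | loc => rfl
  | add a₁ a₂ | sub a₁ a₂ | mul a₁ a₂ =>
    have hle := le_pair a₁.rank a₂.rank
    rw [postorderFrom, hget _ a₁ (by rw [rank]; omega), hget _ a₂ (by rw [rank]; omega), postorder]

theorem AExp.computable₂_postorderFrom : Computable₂ postorderFrom := by
  have hget {f : AExp × AExp → AExp} (hf : Computable f) :
      Computable fun q : List (List AExp) × AExp × AExp => q.1.getD (f q.2).rank [] :=
    (Primrec.list_getD []).to_comp.comp .fst (Computable.encode.comp (hf.comp .snd))
  have hleaf {f : ℕ → AExp} (hf : Computable f) :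
      Computable₂ fun (_ : List (List AExp)) n => [f n] :=
    Computable.list_cons.comp (hf.comp .snd) (.const [])
  have hnode {f : AExp × AExp → AExp} (hf : Computable f) :
      Computable₂ fun (L : List (List AExp)) p =>
        L.getD p.1.rank [] ++ L.getD p.2.rank [] ++ [f p] :=
    Computable.list_concat.comp (Computable.list_append.comp (hget .fst) (hget .snd))
      (hf.comp .snd)
  exact computable₂_cases (.const [readbit]) (hleaf computable_num) (hleaf computable_loc)
    (hnode computable_add) (hnode computable_sub) (hnode computable_mul)

theorem AExp.computable_postorder : Computable postorder := by
  have hsymm : Computable rankEquiv.symm := computable_symm rankEquiv Computable.encode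
  have htable : Computable₂ fun (_ : Unit) n => (rankEquiv.symm n).postorder := by
    refine Computable.nat_strong_rec _
      (g := fun _ L => some ((rankEquiv.symm L.length).postorderFrom L))
      (Computable.option_some.comp <| computable₂_postorderFrom.comp .snd <|
        hsymm.comp (Computable.list_length.comp .snd)) fun _ n => ?_
    obtain ⟨a, rfl⟩ := rankEquiv.surjective n
    rw [List.length_map, List.length_range, rankEquiv.symm_apply_apply]
    exact congrArg some a.postorderFrom_table
  exact (htable.comp (.const ()) Computable.encode).of_eq fun a =>
    congrArg postorder (rankEquiv.symm_apply_apply a)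

theorem primrec₂_memory : Primrec₂ memory :=
  Primrec.list_getD 0

theorem primrec_store : Primrec fun t : List ℕ × ℕ × ℕ => store t.1 t.2.1 t.2.2 := by
  have hn : Primrec fun t : List ℕ × ℕ × ℕ => t.2.1 := Primrec.fst.comp .snd
  have hlength : Primrec fun t : List ℕ × ℕ × ℕ => max t.1.length (t.2.1 + 1) :=
    Primrec.nat_max.comp (Primrec.list_length.comp .fst) (Primrec.succ.comp hn)
  have hentry : Primrec₂ fun (t : List ℕ × ℕ × ℕ) i =>
      if i = t.2.1 then t.2.2 else t.1.getD i 0 :=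
    Primrec.ite (Primrec.eq.comp .snd (hn.comp .fst))
      (Primrec.snd.comp (Primrec.snd.comp .fst))
      ((Primrec.list_getD 0).comp (Primrec.fst.comp .fst) .snd)
  exact Primrec.list_map (Primrec.list_range.comp hlength) hentry

theorem AExp.computable₂_push :
    Computable₂ fun (c : List ℕ × List ℕ × List Bool) a => push c.1 c.2 a := by
  have hheadI : Computable (List.headI : List ℕ → ℕ) :=
    (Primrec.option_getD.comp Primrec.list_head? (.const 0)).to_comp.of_eq fun l => by
      cases l <;> rfl
  have hstack : Computable fun c : List ℕ × List ℕ × List Bool => c.2.1 :=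
    Computable.fst.comp .snd
  have hinput : Computable fun c : List ℕ × List ℕ × List Bool => c.2.2 :=
    Computable.snd.comp .snd
  have htail {β : Type} [Primcodable β] : Computable (List.tail : List β → List β) :=
    Primrec.list_tail.to_comp
  have hleaf {f : (List ℕ × List ℕ × List Bool) → ℕ → ℕ} (hf : Computable₂ f) :
      Computable₂ fun c n => some (f c n :: c.2.1, c.2.2) :=
    Computable.option_some.comp <|
      (Computable.list_cons.comp hf (hstack.comp .fst)).pair (hinput.comp .fst)
  have hop {op : ℕ → ℕ → ℕ} (hp : Primrec₂ op) :
      Computable₂ fun (c : List ℕ × List ℕ × List Bool) (_ : AExp × AExp) =>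
        some (op c.2.1.tail.headI c.2.1.headI :: c.2.1.tail.tail, c.2.2) := by
    have hs := hstack.comp (Computable.fst (β := AExp × AExp))
    exact Computable.option_some.comp <|
      (Computable.list_cons.comp (hp.to_comp.comp (hheadI.comp (htail.comp hs)) (hheadI.comp hs))
        (htail.comp (htail.comp hs))).pair (hinput.comp .fst)
  have hread : Computable fun c : List ℕ × List ℕ × List Bool =>
      c.2.2.head?.map fun d => (d.toNat :: c.2.1, c.2.2.tail) :=
    Computable.option_map (Primrec.list_head?.to_comp.comp hinput) <|
      (Computable.list_cons.comp ((Primrec.dom_bool Bool.toNat).to_comp.comp .snd)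
        (hstack.comp .fst)).pair (htail.comp (hinput.comp .fst))
  exact computable₂_cases hread (hleaf .snd)
    (hleaf (primrec₂_memory.to_comp.comp (Computable.fst.comp .fst) .snd))
    (hop Primrec.nat_add) (hop Primrec.nat_sub) (hop Primrec.nat_mul)

theorem AExp.computable_value :
    Computable fun t : AExp × List ℕ × List Bool => t.1.value t.2.1 t.2.2 := by
  have hstate : Computable fun q : ((AExp × List ℕ × List Bool) ×
      Option (List ℕ × List Bool) × AExp) × List ℕ × List Bool => (q.1.1.2.1, q.2) :=
    (Computable.fst.comp (Computable.snd.comp (Computable.fst.comp .fst))).pair .snd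
  have hexpr : Computable fun q : ((AExp × List ℕ × List Bool) ×
      Option (List ℕ × List Bool) × AExp) × List ℕ × List Bool => q.1.2.2 :=
    Computable.snd.comp (Computable.snd.comp .fst)
  have hpush := computable₂_push.comp hstate hexpr
  have hstart : Computable fun t : AExp × List ℕ × List Bool => some (([] : List ℕ), t.2.2) :=
    Computable.option_some.comp ((Computable.const []).pair (Computable.snd.comp .snd))
  have hfold := computable_list_foldl (computable_postorder.comp .fst) hstart
    (Computable.option_bind (Computable.fst.comp .snd) hpush.to₂).to₂
  have hresult : Computable fun s : List ℕ × List Bool => (s.1.head?.getD 0, s.2) :=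
    (Primrec.option_getD.comp (Primrec.list_head?.comp .fst) (.const 0)).to_comp.pair .snd
  refine (Computable.option_map hfold (hresult.comp .snd).to₂).of_eq fun t =>
    (congrArg (Option.map _) (foldl_push_postorder t.1 t.2.1 (some ([], t.2.2)))).trans ?_
  rw [Option.bind_some, Option.map_map]
  exact Option.map_id'

section Interpreter

variable {α σ : Type*} [Primcodable α] [Primcodable σ]

theorem AExp.computable_value_comp {a : α → AExp} {l : α → List ℕ} {y : α → List Bool}
    (ha : Computable a) (hl : Computable l) (hy : Computable y) :
    Computable fun c => (a c).value (l c) (y c) :=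
  computable_value.comp (ha.pair (hl.pair hy))

theorem AExp.computable_value₂_comp {a₁ a₂ : α → AExp} {l : α → List ℕ} {y : α → List Bool}
    (ha₁ : Computable a₁) (ha₂ : Computable a₂) (hl : Computable l) (hy : Computable y) :
    Computable fun c => value₂ (a₁ c) (a₂ c) (l c) (y c) := by
  have hsecond : Computable₂ fun (c : α) (p : ℕ × List Bool) => (a₂ c).value (l c) p.2 :=
    computable_value_comp (ha₂.comp .fst) (hl.comp .fst) (Computable.snd.comp .snd)
  have hvalues : Computable₂ fun (r : α × ℕ × List Bool) (q : ℕ × List Bool) => (r.2.1, q) :=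
    (Computable.fst.comp (Computable.snd.comp .fst)).pair .snd
  exact Computable.option_bind (computable_value_comp ha₁ hl hy)
    (Computable.option_map hsecond hvalues)

theorem AExp.computable_compare {R : ℕ → ℕ → Prop} [DecidableRel R] (hR : PrimrecRel R)
    {a₁ a₂ : α → AExp} {l : α → List ℕ} {y : α → List Bool} {g h : α → σ}
    (ha₁ : Computable a₁) (ha₂ : Computable a₂) (hl : Computable l) (hy : Computable y)
    (hg : Computable g) (hh : Computable h) :
    Computable fun c => (value₂ (a₁ c) (a₂ c) (l c) (y c)).map fun p =>
      (if R p.1 p.2.1 then g c else h c, p.2.2) := by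
  have hselect : Computable₂ fun (c : α) (p : ℕ × ℕ × List Bool) =>
      if R p.1 p.2.1 then g c else h c :=
    (Computable.cond (hR.decide.to_comp.comp (Computable.fst.comp .snd)
      (Computable.fst.comp (Computable.snd.comp .snd))) (hg.comp .fst) (hh.comp .fst)).of_eq
      fun q => Bool.cond_decide ..
  exact Computable.option_map (computable_value₂_comp ha₁ ha₂ hl hy)
    (hselect.pair (Computable.snd.comp (Computable.snd.comp .snd)))

theorem Sentence.computable_seq_comp {P Q : α → Sentence} (hP : Computable P)
    (hQ : Computable Q) : Computable fun c => seq (P c) (Q c) :=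
  computable_seq.comp (hP.pair hQ)

theorem Sentence.computable_ite_comp {b : α → BExp} {P Q : α → Sentence} (hb : Computable b)
    (hP : Computable P) (hQ : Computable Q) : Computable fun c => ite (b c) (P c) (Q c) :=
  computable_ite.comp (hb.pair (hP.pair hQ))

theorem BExp.computable₂_branch {P Q : α → Sentence} {l : α → List ℕ} {y : α → List Bool}
    (hP : Computable P) (hQ : Computable Q) (hl : Computable l) (hy : Computable y) :
    Computable₂ fun c b => branch (P c) (Q c) (l c) (y c) b := by
  have hcompare {R : ℕ → ℕ → Prop} [DecidableRel R] (hR : PrimrecRel R) :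
      Computable₂ fun c (a : AExp × AExp) =>
        (AExp.value₂ a.1 a.2 (l c) (y c)).map fun p =>
          (if R p.1 p.2.1 then P c else Q c, p.2.2) :=
    AExp.computable_compare hR (Computable.fst.comp .snd) (Computable.snd.comp .snd)
      (hl.comp .fst) (hy.comp .fst) (hP.comp .fst) (hQ.comp .fst)
  have hsplit {β : Type} [Primcodable β] {f : α × β → Sentence} (hf : Computable f) :
      Computable fun d => some (f d, y d.1) :=
    Computable.option_some.comp (hf.pair (hy.comp .fst))
  have hb₁ : Computable fun d : α × BExp × BExp => d.2.1 := Computable.fst.comp .snd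
  have hb₂ : Computable fun d : α × BExp × BExp => d.2.2 := Computable.snd.comp .snd
  have hP₁ : Computable fun d : α × BExp × BExp => P d.1 := hP.comp .fst
  have hQ₁ : Computable fun d : α × BExp × BExp => Q d.1 := hQ.comp .fst
  exact computable₂_cases (Computable.option_some.comp (hP.pair hy))
    (Computable.option_some.comp (hQ.pair hy)) (hcompare Primrec.eq) (hcompare Primrec.nat_lt)
    (hsplit <| Sentence.computable_ite_comp hb₁ (Sentence.computable_ite_comp hb₂ hP₁ hQ₁) hQ₁)
    (hsplit <| Sentence.computable_ite_comp hb₁ hP₁ (Sentence.computable_ite_comp hb₂ hP₁ hQ₁))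
    (hsplit <| Sentence.computable_ite_comp .snd (hQ.comp .fst) (hP.comp .fst))

theorem BExp.computable_branch {b : α → BExp} {P Q : α → Sentence} {l : α → List ℕ}
    {y : α → List Bool} (hb : Computable b) (hP : Computable P) (hQ : Computable Q)
    (hl : Computable l) (hy : Computable y) :
    Computable fun c => (b c).branch (P c) (Q c) (l c) (y c) :=
  (computable₂_branch hP hQ hl hy).comp .id hb

theorem computable_store_comp {l : α → List ℕ} {i v : α → ℕ} (hl : Computable l)
    (hi : Computable i) (hv : Computable v) : Computable fun c => store (l c) (i c) (v c) :=
  primrec_store.to_comp.comp (hl.pair (hi.pair hv))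

theorem computable₂_assign : Computable₂ fun (c : Config) (p : ℕ × AExp) =>
    (p.2.value c.2.1 c.2.2).map fun q => (c.1, store c.2.1 p.1 q.1, q.2) := by
  have hl : Computable fun c : Config => c.2.1 := Computable.fst.comp .snd
  have hy : Computable fun c : Config => c.2.2 := Computable.snd.comp .snd
  have hvalue : Computable fun d : Config × ℕ × AExp => d.2.2.value d.1.2.1 d.1.2.2 :=
    AExp.computable_value_comp (Computable.snd.comp .snd) (hl.comp .fst) (hy.comp .fst)
  have hstore : Computable fun e : (Config × ℕ × AExp) × ℕ × List Bool =>
      store e.1.1.2.1 e.1.2.1 e.2.1 :=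
    computable_store_comp (hl.comp (Computable.fst.comp .fst))
      (Computable.fst.comp (Computable.snd.comp .fst)) (Computable.fst.comp .snd)
  have hresult : Computable₂ fun (d : Config × ℕ × AExp) (q : ℕ × List Bool) =>
      (d.1.1, store d.1.2.1 d.2.1 q.1, q.2) :=
    (Computable.fst.comp (Computable.fst.comp .fst)).pair
      (hstore.pair (Computable.snd.comp .snd))
  exact Computable.option_map hvalue hresult

theorem computable₂_branch_push :
    Computable₂ fun (c : Config) (p : BExp × Sentence × Sentence) =>
      (p.1.branch p.2.1 p.2.2 c.2.1 c.2.2).map fun q => (q.1 :: c.1, c.2.1, q.2) := by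
  have hl : Computable fun c : Config => c.2.1 := Computable.fst.comp .snd
  have hy : Computable fun c : Config => c.2.2 := Computable.snd.comp .snd
  have hbranch : Computable fun d : Config × BExp × Sentence × Sentence =>
      d.2.1.branch d.2.2.1 d.2.2.2 d.1.2.1 d.1.2.2 :=
    BExp.computable_branch (Computable.fst.comp .snd)
      (Computable.fst.comp (Computable.snd.comp .snd))
      (Computable.snd.comp (Computable.snd.comp .snd)) (hl.comp .fst) (hy.comp .fst)
  have hresult : Computable₂ fun (d : Config × BExp × Sentence × Sentence)
      (q : Sentence × List Bool) => (q.1 :: d.1.1, d.1.2.1, q.2) :=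
    (Computable.list_cons.comp (Computable.fst.comp .snd)
      (Computable.fst.comp (Computable.fst.comp .fst))).pair
      ((hl.comp (Computable.fst.comp .fst)).pair (Computable.snd.comp .snd))
  exact Computable.option_map hbranch hresult

theorem Sentence.computable₂_next :
    Computable₂ fun (c : Config) P => next c.1 c.2.1 c.2.2 P := by
  have hreplace {β : Type} [Primcodable β] {f : Config × β → List Sentence} (hf : Computable f) :
      Computable fun d : Config × β => some (f d, d.1.2) :=
    Computable.option_some.comp (hf.pair (Computable.snd.comp .fst))
  have hK {β : Type} [Primcodable β] : Computable fun d : Config × β => d.1.1 :=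
    Computable.fst.comp .fst
  have hloop : Computable fun d : Config × BExp × Sentence => whileDo d.2.1 d.2.2 :=
    computable_whileDo.comp .snd
  have hbody : Computable fun d : Config × BExp × Sentence =>
      seq d.2.2 (.whileDo d.2.1 d.2.2) :=
    computable_seq_comp (Computable.snd.comp .snd) hloop
  have hunfold : Computable fun d : Config × BExp × Sentence =>
      ite d.2.1 (.seq d.2.2 (.whileDo d.2.1 d.2.2)) .skip :=
    computable_ite_comp (Computable.fst.comp .snd) hbody (.const skip)
  have hwhile : Computable₂ fun (c : Config) (p : BExp × Sentence) =>
      next c.1 c.2.1 c.2.2 (.whileDo p.1 p.2) :=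
    hreplace (Computable.list_cons.comp hunfold hK)
  have hseq : Computable₂ fun (c : Config) (p : Sentence × Sentence) =>
      next c.1 c.2.1 c.2.2 (.seq p.1 p.2) :=
    hreplace (Computable.list_cons.comp (Computable.fst.comp .snd)
      (Computable.list_cons.comp (Computable.snd.comp .snd) hK))
  exact computable₂_cases Computable.option_some computable₂_assign hwhile hseq
    computable₂_branch_push

theorem computable_step : Computable step := by
  have hnext : Computable₂ fun (c : Config) P => Sentence.next c.1.tail c.2.1 c.2.2 P :=
    Sentence.computable₂_next.comp
      (((Primrec.list_tail.to_comp.comp .fst).pair .snd).comp .fst) .snd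
  refine (Computable.option_bind (Primrec.list_head?.to_comp.comp .fst) hnext).of_eq ?_
  rintro ⟨_ | _, _⟩ <;> rfl

theorem computable_flatMap_bstr : Computable fun l : List ℕ => l.flatMap bstr := by
  refine (computable_list_foldl .id (.const []) (h := fun _ p => p.1 ++ bstr p.2)
    (Computable.list_append.comp (Computable.fst.comp .snd)
      (computable_bstr.comp (Computable.snd.comp .snd)))).of_eq fun l => ?_
  simp [List.flatMap_def]

theorem Sentence.partrec_run : Partrec₂ run := by
  have hisEmpty {β : Type} [Primcodable β] : Computable (List.isEmpty : List β → Bool) :=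
    (Primrec.eq.decide.comp Primrec.list_length (.const 0)).to_comp.of_eq fun l => by
      cases l <;> simp
  have houtput : Computable fun c : Config =>
      bif c.1.isEmpty && c.2.2.isEmpty then some (c.2.1.flatMap bstr) else none :=
    Computable.cond (Primrec.and.to_comp.comp (hisEmpty.comp .fst)
        (hisEmpty.comp (Computable.snd.comp .snd)))
      (Computable.option_some.comp (computable_flatMap_bstr.comp (Computable.fst.comp .snd)))
      (.const none)
  have hstart : Computable fun q : Sentence × List Bool => (([q.1], [], q.2) : Config) :=
    (Computable.list_cons.comp .fst (.const [])).pair ((Computable.const []).pair .snd)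
  refine (((partrec_stateTransition_eval computable_step).comp hstart).bind
    (houtput.comp .snd).ofOption.to₂).of_eq fun q => ?_
  ext x
  simp only [mem_run, outputs_iff_mem_eval, Part.mem_bind_iff]
  constructor
  · rintro ⟨⟨_ | ⟨P, K⟩, l, _ | ⟨d, y⟩⟩, hc, hx⟩
    · exact ⟨l, hc, by simpa using hx⟩
    all_goals simp at hx
  · rintro ⟨l, hc, rfl⟩
    exact ⟨_, hc, by simp⟩

theorem partrec_machine : Partrec machine := by
  obtain ⟨decode, hdecode, hmem⟩ := exists_partrec_inverse
    (f := fun q : ℕ × List Bool => twoPart q.1 q.2) computable_twoPart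
    fun _ _ h => Prod.ext_iff.2 (twoPart_inj h)
  refine (hdecode.bind ((Sentence.partrec_run.comp (computable_sentence.comp .fst) .snd).comp
    .snd).to₂).of_eq fun p => ?_
  ext x
  simp only [mem_machine, Part.mem_bind_iff, hmem, Prod.exists, Sentence.mem_run]
  constructor
  · rintro ⟨n, y, rfl, h⟩
    exact ⟨n, y, rfl, h⟩
  · rintro ⟨n, y, rfl, h⟩
    exact ⟨n, y, rfl, h⟩

theorem isPrefixMachine_machine : IsPrefixMachine machine :=
  ⟨partrec_machine, machine_prefixFree⟩

end Interpreter

end Imp2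

theorem proposition1 :
    AdditivelyOptimal Imp2.machine {G | IsPrefixMachine G} ∧
      ∀ G : List Bool →. List Bool, IsPrefixMachine G →
        (∃ n : ℕ, ∀ y : List Bool,
          Imp2.machine (Imp2.twoPart n y) = (Imp2.sentence n).run y ∧
            (Imp2.sentence n).run y = G y) ∧
        ∀ n : ℕ, (∀ y : List Bool, (Imp2.sentence n).run y = G y) →
          ∀ x : List Bool,
            complexity Imp2.machine x ≤
              complexity G x + (2 * (Imp2.bstr n).length + 1 : ℕ) := by
  refine ⟨⟨Imp2.isPrefixMachine_machine, fun G hG => ?_⟩, fun G hG => ⟨?_, fun n hn x =>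
    Imp2.complexity_machine_le hn x⟩⟩
  · obtain ⟨n, hn⟩ := Imp2.exists_run_eq hG
    exact ⟨_, Imp2.complexity_machine_le hn⟩
  · obtain ⟨n, hn⟩ := Imp2.exists_run_eq hG
    exact ⟨n, fun y => ⟨Imp2.machine_twoPart n y, hn y⟩⟩
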